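/- Let $X$ be a continuous-time Markov process on a finite set $E$ with infinitesimal generator $A$ (nonnegative off-diagonal entries, zero row sums), jump rates $a(x)=-A(x,x)$, and embedded chain with transition matrix $P$ given by $P(x,x')=-A(x,x')/A(x,x)$ for $x'\neq x$ and $P(x,x)=0$; assume that $P$ is irreducible. Let $\lambda:E\to[0,\infty)$ and $\sigma:E\to(0,\infty)$, put $$M=\{x\in E:\lambda(x)>0\},\qquad N=\{x\in E:\lambda(x)=0\},$$ and assume that both $M$ and $N$ are nonempty. Let $$\beta(x)=\frac{\sigma(x)^2}{2a(x)},\qquad \overline\beta=\max_{x\in N}\beta(x),$$ and for $v\in\mathbb R$ with $v^2<1/\overline\beta$ let $$P^{(N)}_v=\left(\frac{1}{1-\beta(x)v^2}\,P(x,x')\right)_{x,x'\in N}.$$ For $x\in N$ let $X^x$ be the process $X$ started at $x$ (with right-continuous paths), let $B$ be a standard Brownian motion independent of $X^x$, let $T=\inf\{t\ge 0: X^x_t\in M\}$, and let $$I_x=\int_0^T\sigma(X^x_s)\,dB_s .$$ Then, for every $v\in\mathbb R$ with $v^2<1/\overline\beta$, the following two conditions are equivalent: 1. for every $x\in N$,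 $\mathbb E\left(e^{vI_x}\right)<+\infty$; 2. $\rho\big(P^{(N)}_v\big)<1$, where $\rho$ denotes the spectral radius. -/

import Mathlib

open MeasureTheory ProbabilityTheory
open scoped NNReal ENNReal

/-- `A` is the infinitesimal generator of a continuous-time Markov chain on the finite set `E`:
nonnegative off-diagonal entries and zero row sums. -/
structure IsGenerator {E : Type*} [Fintype E] (A : Matrix E E ℝ) : Prop where
  off_diag_nonneg : ∀ x y, x ≠ y → 0 ≤ A x y
  row_sum : ∀ x, ∑ y, A x y = 0

/-- The jump rate `a(x) = -A(x,x)`. -/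
def jumpRate {E : Type*} (A : Matrix E E ℝ) (x : E) : ℝ := -A x x

/-- The transition matrix `P` of the embedded chain: `P(x,y) = -A(x,y)/A(x,x)` for `x ≠ y`, with
zero diagonal. -/
noncomputable def embeddedMatrix {E : Type*} [DecidableEq E] (A : Matrix E E ℝ) : Matrix E E ℝ :=
  Matrix.of fun x y => if x = y then 0 else -A x y / A x x

/-- `X` is (under `μ`) a Markov process with generator `A` started at `x₀`, in the
jump chain / holding times description: almost surely `X` is the right-continuous path which stays
in `Z 0` during a time `S 0`, then in `Z 1` during a time `S 1`, and so on, where `Z` is a Markov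
chain with transition matrix `P` started at `x₀` and where, given `Z`, the holding times `S 0`,
`S 1`, ... are independent, `S n` being exponential with parameter `a(Z n)`. (The rates being
bounded, the sum of all the holding times is almost surely infinite, so that the path is
described on all of `[0, ∞)`.) -/
def IsMarkovProcessFrom {E Ω : Type*} [Fintype E] [DecidableEq E] [MeasurableSpace E]
    [MeasurableSpace Ω] (A : Matrix E E ℝ) (x₀ : E) (X : ℝ≥0 → Ω → E) (μ : Measure Ω) : Prop :=
  (∀ t, Measurable (X t)) ∧
  ∃ (Z : ℕ → Ω → E) (S : ℕ → Ω → ℝ≥0),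
    (∀ n, Measurable (Z n)) ∧ (∀ n, Measurable (S n)) ∧
    (∀ (n : ℕ) (z : Fin (n + 1) → E) (t : Fin (n + 1) → ℝ≥0),
      μ {ω | ∀ i : Fin (n + 1), Z i ω = z i ∧ t i < S i ω} =
        ENNReal.ofReal ((if z 0 = x₀ then 1 else 0) *
          (∏ i : Fin n, embeddedMatrix A (z i.castSucc) (z i.succ)) *
          ∏ i : Fin (n + 1), Real.exp (-(jumpRate A (z i) * t i)))) ∧
    (∀ᵐ ω ∂μ, ∀ (n : ℕ) (s : ℝ≥0), ∑ i ∈ Finset.range n, S i ω ≤ s →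
      s < ∑ i ∈ Finset.range (n + 1), S i ω → X s ω = Z n ω)

/-- `r` is the elementary integral `∫₀ᵀ f(s) db(s)` of the right-continuous step function `f` with
respect to `b`: there are times `0 = t 0 ≤ t 1 ≤ ... ≤ t n = T` such that `f` is constant on each
`[t i, t (i+1))`, and `r = ∑ i < n, f (t i) * (b (t (i+1)) - b (t i))`. -/
def IsStepIntegral (f b : ℝ≥0 → ℝ) (T : ℝ≥0) (r : ℝ) : Prop :=
  ∃ (n : ℕ) (t : ℕ → ℝ≥0), Monotone t ∧ t 0 = 0 ∧ t n = T ∧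
    (∀ i < n, ∀ s, t i ≤ s → s < t (i + 1) → f s = f (t i)) ∧
    r = ∑ i ∈ Finset.range n, f (t i) * (b (t (i + 1)) - b (t i))

/-- The elementary integral does not depend on the subdivision. -/
theorem IsStepIntegral.unique {f b : ℝ≥0 → ℝ} {T : ℝ≥0} {r r' : ℝ}
    (h : IsStepIntegral f b T r) (h' : IsStepIntegral f b T r') : r = r' := by
  obtain ⟨n, t, tm, t0, tn, tf, rfl⟩ := h
  obtain ⟨m, u, um, u0, un, uf, rfl⟩ := h'
  have key : ∀ (n m : ℕ) (t u : ℕ → ℝ≥0), Monotone t → Monotone u → u 0 = 0 → u m = T → t n = T →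
      ∑ i ∈ Finset.range n, f (t i) * (b (t (i + 1)) - b (t i)) =
      ∑ i ∈ Finset.range n, ∑ j ∈ Finset.range m, f (t i) *
        (b (max (t i) (min (u (j + 1)) (t (i + 1)))) - b (max (t i) (min (u j) (t (i + 1))))) := by
    intro n m t u tm um u0 um' tn
    refine Finset.sum_congr rfl fun i hi => ?_
    rw [← Finset.mul_sum, Finset.sum_range_sub (fun j => b (max (t i) (min (u j) (t (i + 1)))))]
    have h1 : t i ≤ t (i + 1) := tm (Nat.le_succ i)
    have h2 : t (i + 1) ≤ T := tn ▸ tm (Finset.mem_range.1 hi)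
    rw [um', u0, min_eq_right h2, max_eq_right h1, min_eq_left zero_le, max_eq_left zero_le]
  rw [key n m t u tm um u0 un tn, key m n u t um tm t0 tn un, Finset.sum_comm]
  refine Finset.sum_congr rfl fun j hj => Finset.sum_congr rfl fun i hi => ?_
  have h1 : t i ≤ t (i + 1) := tm (Nat.le_succ i)
  have h2 : u j ≤ u (j + 1) := um (Nat.le_succ j)
  by_cases hc : max (t i) (u j) < min (t (i + 1)) (u (j + 1))
  · have hs1 : max (t i) (u j) < t (i + 1) := hc.trans_le (min_le_left _ _)
    have hs2 : max (t i) (u j) < u (j + 1) := hc.trans_le (min_le_right _ _)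
    have e : f (t i) = f (u j) := by
      rw [← tf i (Finset.mem_range.1 hi) _ (le_max_left _ _) hs1,
        ← uf j (Finset.mem_range.1 hj) _ (le_max_right _ _) hs2]
    have g1 : t i ≤ min (u (j + 1)) (t (i + 1)) :=
      le_min ((le_max_left _ _).trans hs2.le) h1
    have g2 : u j ≤ min (t (i + 1)) (u (j + 1)) :=
      le_min ((le_max_right _ _).trans hs1.le) h2
    rw [e, max_eq_right g1, max_eq_right g2, min_eq_left ((le_max_right (t i) (u j)).trans hs1.le),
      min_eq_left ((le_max_left (t i) (u j)).trans hs2.le), max_comm (t i) (u j),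
      min_comm (u (j + 1))]
  · have e1 : max (t i) (min (u (j + 1)) (t (i + 1))) = max (t i) (min (u j) (t (i + 1))) ∧
        max (u j) (min (t (i + 1)) (u (j + 1))) = max (u j) (min (t i) (u (j + 1))) := by
      generalize t i = a, t (i + 1) = a', u j = c, u (j + 1) = c' at hc h1 h2 ⊢
      rw [not_lt, min_le_iff, le_max_iff, le_max_iff] at hc
      rcases hc with (h | h) | (h | h)
      · obtain rfl : a = a' := le_antisymm h1 h
        exact ⟨by simp, rfl⟩
      · constructor
        · rw [min_eq_right h, min_eq_right (h.trans h2)]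
        · rw [max_eq_left ((min_le_left _ _).trans h),
            max_eq_left ((min_le_left _ _).trans (h1.trans h))]
      · constructor
        · rw [max_eq_left ((min_le_left _ _).trans h),
            max_eq_left ((min_le_left _ _).trans (h2.trans h))]
        · rw [min_eq_right h, min_eq_right (h.trans h1)]
      · obtain rfl : c = c' := le_antisymm h2 h
        exact ⟨rfl, by simp⟩
    rw [e1.1, e1.2, sub_self, sub_self, mul_zero, mul_zero]

open Classical in
/-- The integral `∫₀ᵀ f(s) db(s)` of a step function `f` (set to `0` if `f` is not a step function
on `[0, T)`). -/
noncomputable def stepIntegral (f b : ℝ≥0 → ℝ) (T : ℝ≥0) : ℝ :=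
  if h : ∃ r, IsStepIntegral f b T r then h.choose else 0

theorem IsStepIntegral.stepIntegral_eq {f b : ℝ≥0 → ℝ} {T : ℝ≥0} {r : ℝ}
    (h : IsStepIntegral f b T r) : stepIntegral f b T = r := by
  have h' : ∃ r, IsStepIntegral f b T r := ⟨r, h⟩
  rw [stepIntegral, dif_pos h']
  exact h'.choose_spec.unique h

/-- The first time `T = inf {t ≥ 0 : X_t ∈ M}` at which `X` hits `M = {λ > 0}`
(infinite if there is no such time). -/
noncomputable def hitTimeM {E Ω : Type*} (lam : E → ℝ) (X : ℝ≥0 → Ω → E) : Ω → WithTop ℝ≥0 :=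
  hittingAfter X {y | 0 < lam y} 0

/-- The stochastic integral `I = ∫₀ᵀ σ(X_s) dB_s`, with `T` the hitting time of `M = {λ > 0}`.
On `{T < ∞}` the integrand is, almost surely, a step function with finitely many jumps on `[0, T]`,
so that the stochastic integral is the elementary one. On `{T = ∞}`
(a null event for irreducible chains and nonempty `M`) the value is `0`. -/
noncomputable def exitIntegral {E Ω : Type*} (lam σ : E → ℝ) (X : ℝ≥0 → Ω → E)
    (B : ℝ≥0 → Ω → ℝ) (ω : Ω) : ℝ :=
  stepIntegral (fun s => σ (X s ω)) (fun s => B s ω) ((hitTimeM lam X ω).untopD 0)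

/-- The set `N = {λ = 0}`. -/
abbrev NullState {E : Type*} (lam : E → ℝ) : Type _ := {x : E // lam x = 0}

/-- `β(x) = σ(x)² / (2 a(x))`. -/
noncomputable def betaCoeff {E : Type*} (A : Matrix E E ℝ) (σ : E → ℝ) (x : E) : ℝ :=
  σ x ^ 2 / (2 * jumpRate A x)

/-- The maximum of `β` over `N`. -/
noncomputable def betaBar {E : Type*} (A : Matrix E E ℝ) (lam σ : E → ℝ) : ℝ :=
  ⨆ x : NullState lam, betaCoeff A σ x

/-- The matrix `P_v^{(N)}`, indexed by `N`, with entries `P(x,x') / (1 - β(x) v²)`. -/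
noncomputable def matrixPN {E : Type*} [DecidableEq E] (A : Matrix E E ℝ) (lam σ : E → ℝ) (v : ℝ) :
    Matrix (NullState lam) (NullState lam) ℝ :=
  Matrix.of fun x x' => 1 / (1 - betaCoeff A σ x * v ^ 2) * embeddedMatrix A x x'

/-- The spectral radius of a real square matrix: the largest modulus of its complex eigenvalues. -/
noncomputable def matrixSpectralRadius {n : Type*} [Fintype n] [DecidableEq n]
    (Q : Matrix n n ℝ) : ℝ≥0∞ :=
  spectralRadius ℂ (Q.map (fun r : ℝ => (r : ℂ)))

/-! ### Nonnegative matrices: potentials, spectral radius, path sums -/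

section Matrices

open Filter Topology Matrix

variable {ι : Type*} [Fintype ι]

/-! Given the path of `X`, the integral `I` is centered Gaussian with variance `V = ∫₀ᵀ σ(X_s)² ds`,
so `E e^{vI} = E e^{v²V/2}` (`lintegral_exp_exitIntegral`). Only bounded functions pass freely to
the limit, so this goes through characteristic functions: Riemann sums on a grid have coefficients
depending on `X` alone, hence independent of the Brownian increments. In the limit `I` has the law
of `√V` times an independent standard Gaussian.

Next, `V` is the sum of `σ(Z i)² S i` over the steps before the chain leaves `N`. Given the chain, a
visit to `x` contributes the factor `a / (a - v²σ²/2) = 1 / (1 - β v²)`, finite since `v² < 1/β̄`.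
Summing over trajectories and over the exit step gives `∑ W^k g`, with `g` the indicator of `M` and
`W` equal to `Q = P_v^{(N)}` on `N × N` (`lintegral_exp_exitVariance`). At a point of `N` this is `∑
Q^k r`, where `r` is the restriction of `W g`.

It remains to compare finiteness of `F = ∑ Q^k r` with `ρ(Q) < 1`
(`Matrix.tsum_pow_mulVec_lt_top_iff`). Gelfand's formula gives one direction. Conversely, `F ≥ 1`
because `e^{v²V/2} ≥ 1`, so a finite `F` dominates every eigenvector, and the tails `Q^n F → 0`
exclude eigenvalues of modulus at least `1`. No irreducibility of `Q` is needed; that of `P` yields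
positive jump rates and almost sure exit from `N`. -/

theorem Matrix.mulVec_mono_of_nonneg {Q : Matrix ι ι ℝ} (hQ : ∀ i j, 0 ≤ Q i j) {f g : ι → ℝ}
    (h : ∀ i, f i ≤ g i) (i : ι) : (Q *ᵥ f) i ≤ (Q *ᵥ g) i :=
  Finset.sum_le_sum fun j _ => mul_le_mul_of_nonneg_left (h j) (hQ i j)

theorem Matrix.mulVec_nonneg_of_nonneg {Q : Matrix ι ι ℝ} (hQ : ∀ i j, 0 ≤ Q i j) {f : ι → ℝ}
    (h : ∀ i, 0 ≤ f i) (i : ι) : 0 ≤ (Q *ᵥ f) i :=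
  Finset.sum_nonneg fun j _ => mul_nonneg (hQ i j) (h j)

variable [DecidableEq ι]

theorem Matrix.pow_entry_nonneg {Q : Matrix ι ι ℝ} (hQ : ∀ i j, 0 ≤ Q i j) (n : ℕ) (i j : ι) :
    0 ≤ (Q ^ n) i j := by
  induction n generalizing i j with
  | zero => rw [pow_zero, Matrix.one_apply]; split_ifs <;> simp
  | succ n ih =>
    rw [pow_succ, Matrix.mul_apply]
    exact Finset.sum_nonneg fun k _ => mul_nonneg (ih i k) (hQ k j)

theorem Matrix.map_ofReal_pow (Q : Matrix ι ι ℝ) (n : ℕ) :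
    (Q ^ n).map (fun r : ℝ => (r : ℂ)) = (Q.map (fun r : ℝ => (r : ℂ))) ^ n :=
  map_pow (Complex.ofRealHom.mapMatrix (m := ι)) Q n

/-- By Gelfand's formula, `‖Q^n‖ ≤ s^n` for large `n` whenever `ρ(Q) < s < 1`, and the series is
compared with a geometric one. -/
theorem Matrix.summable_pow_mulVec_of_spectralRadius_lt_one {Q : Matrix ι ι ℝ}
    (h : matrixSpectralRadius Q < 1) (r : ι → ℝ) (i : ι) :
    Summable fun k => ((Q ^ k) *ᵥ r) i := by
  let _ : NormedRing (Matrix ι ι ℂ) := Matrix.linftyOpNormedRing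
  let _ : NormedAlgebra ℂ (Matrix ι ι ℂ) := Matrix.linftyOpNormedAlgebra
  set a : Matrix ι ι ℂ := Q.map (fun r : ℝ => (r : ℂ)) with ha
  have hG := spectrum.pow_nnnorm_pow_one_div_tendsto_nhds_spectralRadius a
  obtain ⟨s, hs1, hs2⟩ := ENNReal.lt_iff_exists_nnreal_btwn.1 h
  have hev : ∀ᶠ n : ℕ in atTop, ‖a ^ n‖ ≤ (s : ℝ) ^ n := by
    filter_upwards [hG.eventually_lt_const hs1, eventually_gt_atTop 0] with n hn hn0
    have h1 : (‖a ^ n‖₊ : ℝ≥0∞) < (s : ℝ≥0∞) ^ (n : ℝ) := by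
      rw [one_div, ENNReal.rpow_inv_lt_iff (by exact_mod_cast hn0)] at hn
      exact hn
    rw [ENNReal.rpow_natCast] at h1
    exact_mod_cast h1.le
  have hbd : ∀ n : ℕ, ‖((Q ^ n) *ᵥ r) i‖ ≤ ‖a ^ n‖ * ‖fun j => (r j : ℂ)‖ := by
    intro n
    refine le_trans ?_ (Matrix.linfty_opNorm_mulVec (a ^ n) (fun j => (r j : ℂ)))
    refine le_trans (le_of_eq ?_) (norm_le_pi_norm _ i)
    rw [ha, ← Matrix.map_ofReal_pow]
    simp only [Matrix.mulVec, dotProduct, Matrix.map_apply]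
    rw [← Complex.norm_real]
    push_cast
    rfl
  have hs : Summable fun n : ℕ => (s : ℝ) ^ n * ‖fun j => (r j : ℂ)‖ :=
    (summable_geometric_of_lt_one s.2 (by exact_mod_cast hs2)).mul_right _
  refine summable_of_isBigO_nat hs (Asymptotics.IsBigO.of_bound 1 ?_)
  filter_upwards [hev] with n hn
  rw [one_mul]
  exact ((hbd n).trans (mul_le_mul_of_nonneg_right hn (norm_nonneg _))).trans (le_abs_self _)

/-- Let `F = ∑ Q^k r`. An eigenvector `w` for `z` with `|z| ≥ 1` satisfies `|w| ≤ C F` as `F > 0`,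
hence `|w| ≤ |Q^n w| ≤ C Q^n F`. The right side is `C` times a tail of the convergent series
defining `F`, so `w = 0`. -/
theorem Matrix.spectralRadius_lt_one_of_summable [Nonempty ι] {Q : Matrix ι ι ℝ}
    (hQ : ∀ i j, 0 ≤ Q i j) {r : ι → ℝ} (hs : ∀ i, Summable fun k => ((Q ^ k) *ᵥ r) i)
    (hpos : ∀ i, 0 < ∑' k, ((Q ^ k) *ᵥ r) i) : matrixSpectralRadius Q < 1 := by
  let _ : NormedRing (Matrix ι ι ℂ) := Matrix.linftyOpNormedRing
  let _ : NormedAlgebra ℂ (Matrix ι ι ℂ) := Matrix.linftyOpNormedAlgebra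
  refine spectrum.spectralRadius_lt_of_forall_lt (r := 1) _ fun z hz => ?_
  by_contra hz1
  rw [not_lt] at hz1
  rw [← Matrix.spectrum_toLin', ← Module.End.hasEigenvalue_iff_mem_spectrum] at hz
  obtain ⟨w, hw⟩ := hz.exists_hasEigenvector
  have hpow : ∀ n : ℕ, ((Q ^ n).map (fun r : ℝ => (r : ℂ))) *ᵥ w = z ^ n • w := by
    intro n
    rw [Matrix.map_ofReal_pow]
    induction n with
    | zero => simp
    | succ n ih =>
      have := hw.apply_eq_smul
      rw [Matrix.toLin'_apply] at this
      rw [pow_succ, ← Matrix.mulVec_mulVec, this, Matrix.mulVec_smul, ih, smul_smul, pow_succ,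
        mul_comm]
  set F : ι → ℝ := fun i => ∑' k, ((Q ^ k) *ᵥ r) i with hF
  obtain ⟨C, hC⟩ : ∃ C : ℝ, ∀ i, ‖w i‖ ≤ C * F i := by
    refine ⟨∑ i, ‖w i‖ / F i, fun i => ?_⟩
    rw [← div_le_iff₀ (hpos i)]
    exact Finset.single_le_sum (f := fun i => ‖w i‖ / F i)
      (fun j _ => div_nonneg (norm_nonneg _) (hpos j).le) (Finset.mem_univ i)
  have hQF : ∀ n i, ((Q ^ n) *ᵥ F) i = ∑' k, ((Q ^ (k + n)) *ᵥ r) i := by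
    intro n i
    simp only [Matrix.mulVec, dotProduct, hF]
    simp_rw [← tsum_mul_left]
    rw [← Summable.tsum_finsetSum]
    · refine tsum_congr fun k => ?_
      have := congrFun (Matrix.mulVec_mulVec r (Q ^ n) (Q ^ k)) i
      rw [← pow_add, add_comm n k] at this
      exact this
    · intro j _
      exact (hs j).mul_left _
  have hw0 : w = 0 := by
    ext i
    have hle : ∀ n, ‖w i‖ ≤ C * ∑' k, ((Q ^ (k + n)) *ᵥ r) i := by
      intro n
      calc ‖w i‖ ≤ ‖z ^ n‖ * ‖w i‖ := by
            refine le_mul_of_one_le_left (norm_nonneg _) ?_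
            rw [norm_pow]
            exact one_le_pow₀ (by exact_mod_cast hz1)
        _ = ‖(((Q ^ n).map (fun r : ℝ => (r : ℂ))) *ᵥ w) i‖ := by
            rw [hpow n, Pi.smul_apply, smul_eq_mul, norm_mul]
        _ ≤ ∑ j, (Q ^ n) i j * ‖w j‖ := by
            refine (norm_sum_le _ _).trans (Finset.sum_le_sum fun j _ => ?_)
            simp only [norm_mul, Matrix.map_apply, Complex.norm_real]
            rw [Real.norm_of_nonneg (Matrix.pow_entry_nonneg hQ n i j)]
        _ ≤ ∑ j, (Q ^ n) i j * (C * F j) := Finset.sum_le_sum fun j _ =>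
            mul_le_mul_of_nonneg_left (hC j) (Matrix.pow_entry_nonneg hQ n i j)
        _ = C * ((Q ^ n) *ᵥ F) i := by
            rw [Matrix.mulVec, dotProduct, Finset.mul_sum]
            exact Finset.sum_congr rfl fun j _ => by ring
        _ = _ := by rw [hQF]
    have hlim := (tendsto_sum_nat_add fun k => ((Q ^ k) *ᵥ r) i).const_mul C
    rw [mul_zero] at hlim
    have := ge_of_tendsto' hlim hle
    simpa using this
  exact hw.2 hw0

/-- For a nonnegative matrix `Q` and a nonnegative vector `r` whose potential `∑ Q ^ k r` is
positive, the potential is finite if and only if the spectral radius of `Q` is less than `1`. -/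
theorem Matrix.tsum_pow_mulVec_lt_top_iff [Nonempty ι] {Q : Matrix ι ι ℝ}
    (hQ : ∀ i j, 0 ≤ Q i j) {r : ι → ℝ} (hr : ∀ i, 0 ≤ r i)
    (hpos : ∀ i, 0 < ∑' k, ENNReal.ofReal (((Q ^ k) *ᵥ r) i)) :
    (∀ i, ∑' k, ENNReal.ofReal (((Q ^ k) *ᵥ r) i) < ⊤) ↔ matrixSpectralRadius Q < 1 := by
  have h0 : ∀ k i, 0 ≤ ((Q ^ k) *ᵥ r) i := fun k =>
    Matrix.mulVec_nonneg_of_nonneg (Matrix.pow_entry_nonneg hQ k) hr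
  constructor
  · intro h
    have hs : ∀ i, Summable fun k => ((Q ^ k) *ᵥ r) i := by
      intro i
      have := ENNReal.summable_toReal (h i).ne
      simpa only [ENNReal.toReal_ofReal (h0 _ i)] using this
    refine Matrix.spectralRadius_lt_one_of_summable hQ hs fun i => ?_
    have := hpos i
    rwa [← ENNReal.ofReal_tsum_of_nonneg (fun k => h0 k i) (hs i), ENNReal.ofReal_pos] at this
  · intro h i
    rw [← ENNReal.ofReal_tsum_of_nonneg (fun k => h0 k i)
      (Matrix.summable_pow_mulVec_of_spectralRadius_lt_one h r i)]
    exact ENNReal.ofReal_lt_top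

/-- The entries of `W ^ n *ᵥ g` as sums over paths. -/
theorem Matrix.sum_path_eq_pow_mulVec (W : Matrix ι ι ℝ) (g : ι → ℝ) (x : ι) (n : ℕ) :
    ∑ z : Fin (n + 1) → ι, (if z 0 = x then 1 else 0) *
      (∏ i : Fin n, W (z i.castSucc) (z i.succ)) * g (z (Fin.last n)) = ((W ^ n) *ᵥ g) x := by
  induction n generalizing g with
  | zero =>
    rw [← (Equiv.funUnique (Fin 1) ι).symm.sum_comp]
    simp
  | succ n ih =>
    -- The last vertex of the path is split off with `Fin.snoc`; summing over it replaces the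
    -- terminal vector `g` by `W *ᵥ g`.
    rw [pow_succ, ← Matrix.mulVec_mulVec, ← ih (W *ᵥ g),
      ← (Fin.snocEquiv (fun _ : Fin (n + 2) => ι)).sum_comp, Fintype.sum_prod_type,
      Finset.sum_comm]
    refine Finset.sum_congr rfl fun z _ => ?_
    rw [Matrix.mulVec, dotProduct, Finset.mul_sum]
    refine Finset.sum_congr rfl fun y _ => ?_
    have h0 : (Fin.snoc z y : Fin (n + 2) → ι) 0 = z 0 := by
      rw [← Fin.castSucc_zero, Fin.snoc_castSucc (α := fun _ => ι)]
    simp only [Fin.snocEquiv_apply]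
    rw [Fin.prod_univ_castSucc, h0]
    simp only [Fin.succ_castSucc, Fin.snoc_castSucc (α := fun _ => ι), Fin.succ_last,
      Fin.snoc_last (α := fun _ => ι)]
    ring

/-- For an irreducible stochastic matrix `P`, the probability to stay for ever in a proper subset
`N` is zero. -/
theorem Matrix.tendsto_pow_mulVec_indicator_zero {P : Matrix ι ι ℝ} (hP : P.IsIrreducible)
    (hrow : ∀ x, ∑ y, P x y = 1) (N : ι → Prop) [DecidablePred N] (hN : ∃ x, ¬ N x) (x : ι) :
    Tendsto (fun n : ℕ => (((Matrix.of fun x y => if N x then P x y else 0) ^ n) *ᵥ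
      fun y => if N y then 1 else 0) x) atTop (𝓝 0) := by
  set W : Matrix ι ι ℝ := Matrix.of fun x y => if N x then P x y else 0 with hW
  set e : ι → ℝ := fun y => if N y then 1 else 0 with he
  have hWn : ∀ i j, 0 ≤ W i j := fun i j => by
    simp only [hW, Matrix.of_apply]; split_ifs
    · exact hP.nonneg i j
    · exact le_rfl
  have he0 : ∀ i, 0 ≤ e i := fun i => by simp only [he]; split_ifs <;> norm_num
  have he1 : ∀ i, e i ≤ 1 := fun i => by simp only [he]; split_ifs <;> norm_num
  -- This makes `W ^ n *ᵥ e` decreasing in `n`, so that it has a limit `h`, fixed by `W`.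
  have hWe : ∀ i, (W *ᵥ e) i ≤ e i := fun i => by
    have : (W *ᵥ e) i ≤ ∑ y, W i y := by
      refine Finset.sum_le_sum fun y _ => ?_
      exact mul_le_of_le_one_right (hWn i y) (he1 y)
    refine this.trans ?_
    simp only [hW, he, Matrix.of_apply]
    split_ifs
    · exact (hrow i).le
    · simp
  have h0 : ∀ n i, 0 ≤ ((W ^ n) *ᵥ e) i := fun n =>
    Matrix.mulVec_nonneg_of_nonneg (Matrix.pow_entry_nonneg hWn n) he0
  have hanti : ∀ i, Antitone fun n : ℕ => ((W ^ n) *ᵥ e) i := fun i => by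
    refine antitone_nat_of_succ_le fun n => ?_
    rw [pow_succ, ← Matrix.mulVec_mulVec]
    exact Matrix.mulVec_mono_of_nonneg (Matrix.pow_entry_nonneg hWn n) hWe i
  have hlim : ∀ i, ∃ l, Tendsto (fun n : ℕ => ((W ^ n) *ᵥ e) i) atTop (𝓝 l) := fun i =>
    ⟨_, tendsto_atTop_ciInf (hanti i) ⟨0, by rintro _ ⟨n, rfl⟩; exact h0 n i⟩⟩
  choose h hh using hlim
  have hnn : ∀ i, 0 ≤ h i := fun i => ge_of_tendsto' (hh i) fun n => h0 n i
  have hfix : ∀ i, h i = (W *ᵥ h) i := fun i => by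
    refine tendsto_nhds_unique ((tendsto_add_atTop_iff_nat 1).2 (hh i)) ?_
    simp_rw [pow_succ', ← Matrix.mulVec_mulVec]
    exact tendsto_finsetSum _ fun j _ => (hh j).const_mul _
  have hout : ∀ i, ¬ N i → h i = 0 := fun i hi => by
    rw [hfix i]
    simp [Matrix.mulVec, dotProduct, hW, hi]
  -- `h` is harmonic for `P` on `N` and zero elsewhere, hence subharmonic for `P`.
  have hsub : ∀ i, h i ≤ (P *ᵥ h) i := fun i => by
    by_cases hi : N i
    · rw [hfix i]
      simp [Matrix.mulVec, dotProduct, hW, hi]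
    · rw [hout i hi]
      exact Matrix.mulVec_nonneg_of_nonneg hP.nonneg hnn i
  have hsubk : ∀ k i, h i ≤ ((P ^ k) *ᵥ h) i := by
    intro k
    induction k with
    | zero => simp
    | succ k ih =>
      intro i
      rw [pow_succ, ← Matrix.mulVec_mulVec]
      exact (ih i).trans (Matrix.mulVec_mono_of_nonneg (Matrix.pow_entry_nonneg hP.nonneg k) hsub i)
  have hrowk : ∀ k i, ∑ j, (P ^ k) i j = 1 := by
    intro k
    induction k with
    | zero => simp [Matrix.one_apply]
    | succ k ih =>
      intro i
      simp_rw [pow_succ, Matrix.mul_apply]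
      rw [Finset.sum_comm]
      simp_rw [← Finset.mul_sum, hrow, mul_one]
      exact ih i
  obtain ⟨x₀, hx₀⟩ := hN
  -- Maximum principle: some power of `P` charges `x₀`, where `h` vanishes, from the maximum point
  -- `m`; a positive maximum would then strictly exceed its own average.
  obtain ⟨m, -, hm⟩ := Finset.exists_max_image Finset.univ h ⟨x, Finset.mem_univ x⟩
  have hm0 : h m ≤ 0 := by
    by_contra hpos
    rw [not_le] at hpos
    obtain ⟨k, -, hk⟩ := (Matrix.isIrreducible_iff_exists_pow_pos hP.nonneg).1 hP m x₀
    have h1 : ((P ^ k) *ᵥ h) m < ∑ j, (P ^ k) m j * h m := by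
      refine Finset.sum_lt_sum (fun j _ => mul_le_mul_of_nonneg_left (hm j (Finset.mem_univ j))
        (Matrix.pow_entry_nonneg hP.nonneg k m j)) ⟨x₀, Finset.mem_univ _, ?_⟩
      rw [hout x₀ hx₀, mul_zero]
      exact mul_pos hk hpos
    rw [← Finset.sum_mul, hrowk, one_mul] at h1
    exact absurd (hsubk k m) (not_le.2 h1)
  have : h x = 0 := le_antisymm ((hm x (Finset.mem_univ x)).trans hm0) (hnn x)
  rw [← this]
  exact hh x

/-- Powers of a matrix supported on rows in `N` act on vectors supported in `N` as the powers of
its restriction to `N`. -/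
theorem Matrix.pow_mulVec_eq_submatrix (N : ι → Prop) [DecidablePred N] {W : Matrix ι ι ℝ}
    (hW : ∀ x y, ¬ N x → W x y = 0) {h : ι → ℝ} (hh : ∀ x, ¬ N x → h x = 0) (n : ℕ)
    (x : Subtype N) :
    ((W ^ n) *ᵥ h) x = (((Matrix.of fun x y : Subtype N => W x y) ^ n) *ᵥ fun y => h y) x := by
  induction n generalizing h with
  | zero => simp
  | succ n ih =>
    rw [pow_succ, pow_succ, ← Matrix.mulVec_mulVec, ← Matrix.mulVec_mulVec, ih]
    · congr 2
      ext y
      simp only [Matrix.mulVec, dotProduct, Matrix.of_apply]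
      rw [← Finset.sum_subset (Finset.subset_univ (Finset.univ.filter N)) fun z _ hz => by
        rw [hh z (by simpa using hz), mul_zero]]
      exact Finset.sum_subtype _ (by simp) _
    · intro y hy
      simp [Matrix.mulVec, dotProduct, hW y _ hy]

end Matrices

/-! ### Riemann sums along jump paths and the elementary integral -/

section StepPaths

open Filter Topology

/-- Riemann sums of the indicator function of `[a, a')`. -/
theorem tendsto_riemannSum_indicator_Ico {b : ℝ≥0 → ℝ} (hb : Continuous b) {a a' : ℝ≥0}
    (h : a ≤ a') :
    Tendsto (fun m : ℕ => ∑ j ∈ Finset.range (m ^ 2),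
      (if a ≤ (j : ℝ≥0) / m ∧ (j : ℝ≥0) / m < a' then 1 else 0) *
        (b (((j + 1 : ℕ) : ℝ≥0) / m) - b ((j : ℝ≥0) / m))) atTop (𝓝 (b a' - b a)) := by
  have hr : ∀ a : ℝ≥0, Tendsto (fun m : ℕ => (⌈a * m⌉₊ : ℝ≥0) / m) atTop (𝓝 a) := fun a => by
    rw [← NNReal.tendsto_coe]
    refine ((tendsto_nat_ceil_mul_div_atTop a.2).comp tendsto_natCast_atTop_atTop).congr fun m => ?_
    have : ⌈(a : ℝ) * m⌉₊ = ⌈a * m⌉₊ := by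
      refine eq_of_forall_ge_iff fun k => ?_
      rw [Nat.ceil_le, Nat.ceil_le]
      exact_mod_cast Iff.rfl
    simp only [Function.comp_apply, NNReal.coe_div, NNReal.coe_natCast]
    exact congrArg (fun k : ℕ => (k : ℝ) / m) this
  have hc : ∀ a : ℝ≥0, Tendsto (fun m : ℕ => b ((⌈a * m⌉₊ : ℝ≥0) / m)) atTop (𝓝 (b a)) := fun a =>
    (hb.tendsto a).comp (hr a)
  -- The indices selected are `⌈a m⌉ ≤ j < ⌈a' m⌉`, so the sum telescopes. The condition `m ≥ K ≥
  -- a'` ensures that the grid, which stops at time `m`, covers `[0, a')`.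
  refine ((hc a').sub (hc a)).congr' ?_
  obtain ⟨K, hK⟩ := exists_nat_ge a'
  filter_upwards [eventually_gt_atTop 0, eventually_ge_atTop K] with m hm hKm
  have hm' : (0 : ℝ≥0) < m := by exact_mod_cast hm
  have hle : ⌈a * m⌉₊ ≤ ⌈a' * m⌉₊ := Nat.ceil_le_ceil (by gcongr)
  have hle' : ⌈a' * m⌉₊ ≤ m ^ 2 := by
    refine Nat.ceil_le.2 ?_
    rw [pow_two]
    push_cast
    gcongr
    exact hK.trans (by exact_mod_cast hKm)
  rw [← Finset.sum_Ico_sub (fun j : ℕ => b ((j : ℝ≥0) / m)) hle]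
  simp only [ite_mul, one_mul, zero_mul]
  rw [← Finset.sum_filter]
  refine Finset.sum_congr ?_ fun _ _ => rfl
  ext j
  rw [Finset.mem_Ico, Finset.mem_filter, Finset.mem_range, Nat.ceil_le, Nat.lt_ceil,
    le_div_iff₀ hm', div_lt_iff₀ hm']
  refine ⟨fun hj => ⟨?_, hj⟩, fun hj => hj.2⟩
  exact lt_of_lt_of_le (Nat.lt_ceil.2 hj.2) hle'

theorem exists_mem_step_interval {n : ℕ} {t : ℕ → ℝ≥0} (ht0 : t 0 = 0) {s : ℝ≥0} (hs : s < t n) :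
    ∃ i < n, t i ≤ s ∧ s < t (i + 1) := by
  induction n with
  | zero => exact absurd hs (by rw [ht0]; exact not_lt_zero)
  | succ n ih =>
    rcases le_or_gt (t n) s with h | h
    · exact ⟨n, n.lt_succ_self, h, hs⟩
    · obtain ⟨i, hi, h⟩ := ih h
      exact ⟨i, hi.trans n.lt_succ_self, h⟩

/-- Riemann sums of a step function, killed at the time `t n`, along a grid of mesh `1 / m`. -/
theorem tendsto_riemannSum_step {b : ℝ≥0 → ℝ} (hb : Continuous b) {n : ℕ} {t : ℕ → ℝ≥0}
    (ht : Monotone t) (ht0 : t 0 = 0) {c : ℕ → ℝ} {G : ℕ → ℕ → ℝ}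
    (hG : ∀ᶠ m : ℕ in atTop, ∀ j : ℕ, (∀ i < n, t i ≤ (j : ℝ≥0) / m → (j : ℝ≥0) / m < t (i + 1) →
      G m j = c i) ∧ (t n ≤ (j : ℝ≥0) / m → G m j = 0)) :
    Tendsto (fun m : ℕ => ∑ j ∈ Finset.range (m ^ 2),
      G m j * (b (((j + 1 : ℕ) : ℝ≥0) / m) - b ((j : ℝ≥0) / m))) atTop
      (𝓝 (∑ i ∈ Finset.range n, c i * (b (t (i + 1)) - b (t i)))) := by
  have h1 := tendsto_finsetSum (Finset.range n) fun i _ =>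
    (tendsto_riemannSum_indicator_Ico hb (ht (Nat.le_succ i))).const_mul (c i)
  refine h1.congr' ?_
  filter_upwards [hG] with m hm
  simp_rw [Finset.mul_sum]
  rw [Finset.sum_comm]
  refine Finset.sum_congr rfl fun j _ => ?_
  simp_rw [← mul_assoc]
  rw [← Finset.sum_mul]
  congr 1
  obtain ⟨h1, h2⟩ := hm j
  generalize (j : ℝ≥0) / m = s at h1 h2
  rcases le_or_gt (t n) s with hs | hs
  · rw [h2 hs]
    refine Finset.sum_eq_zero fun i hi => ?_
    rw [if_neg, mul_zero]
    exact fun h => absurd (h.2.trans_le (ht (Finset.mem_range.1 hi))) (not_lt.2 hs)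
  · obtain ⟨i, hi, hi1, hi2⟩ := exists_mem_step_interval ht0 hs
    rw [h1 i hi hi1 hi2, Finset.sum_eq_single i, if_pos ⟨hi1, hi2⟩, mul_one]
    · intro k _ hki
      rw [if_neg, mul_zero]
      rintro ⟨hk1, hk2⟩
      rcases lt_or_gt_of_ne hki with h | h
      · exact absurd (hk2.trans_le ((ht (Nat.succ_le_of_lt h)).trans hi1)) (lt_irrefl _)
      · exact absurd (hi2.trans_le ((ht (Nat.succ_le_of_lt h)).trans hk1)) (lt_irrefl _)
    · exact fun h => absurd (Finset.mem_range.2 hi) h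

/-- A path staying in `z n` during the time `S n`, with `z` first entering `D` at step `k`: the
coefficients of the Riemann sums of `f` along the path stopped when visiting `D` on the grid. -/
theorem tendsto_riemannSum_jumpPath {E : Type*} {X : ℝ≥0 → E} {z : ℕ → E} {S : ℕ → ℝ≥0}
    (hX : ∀ (n : ℕ) (s : ℝ≥0), ∑ i ∈ Finset.range n, S i ≤ s →
      s < ∑ i ∈ Finset.range (n + 1), S i → X s = z n)
    (N : E → Prop) [DecidablePred N] {k : ℕ} (hz : ∀ i < k, N (z i)) (hzk : ¬ N (z k))
    (hS : 0 < S k) (f : E → ℝ) {b : ℝ≥0 → ℝ} (hb : Continuous b) :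
    Tendsto (fun m : ℕ => ∑ j ∈ Finset.range (m ^ 2),
      (if ∀ i ≤ j, N (X ((i : ℝ≥0) / m)) then f (X ((j : ℝ≥0) / m)) else 0) *
        (b (((j + 1 : ℕ) : ℝ≥0) / m) - b ((j : ℝ≥0) / m))) atTop
      (𝓝 (∑ i ∈ Finset.range k, f (z i) * (b (∑ l ∈ Finset.range (i + 1), S l) -
        b (∑ l ∈ Finset.range i, S l)))) := by
  have ht : Monotone fun n => ∑ i ∈ Finset.range n, S i :=
    monotone_nat_of_le_succ fun n => by rw [Finset.sum_range_succ]; exact le_self_add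
  refine tendsto_riemannSum_step (t := fun n => ∑ i ∈ Finset.range n, S i) hb ht (by simp)
    (c := fun i => f (z i)) (G := fun m j =>
      if ∀ i ≤ j, N (X ((i : ℝ≥0) / m)) then f (X ((j : ℝ≥0) / m)) else 0) ?_
  -- Once `1 / m < S k`, the first grid time `⌈T m⌉ / m` after the exit time `T` still lies in the
  -- holding interval of `z k`, so the grid detects the exit.
  obtain ⟨K, hK⟩ := exists_nat_gt (S k)⁻¹
  filter_upwards [eventually_gt_atTop 0, eventually_ge_atTop K] with m hm hKm j
  have hm' : (0 : ℝ≥0) < m := by exact_mod_cast hm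
  constructor
  · intro i hi h1 h2
    rw [hX i _ h1 h2, if_pos]
    intro l hl
    have hlt : (l : ℝ≥0) / m < ∑ i ∈ Finset.range k, S i :=
      lt_of_le_of_lt (by gcongr) (h2.trans_le (ht (Nat.succ_le_of_lt hi)))
    obtain ⟨p, hp, hp1, hp2⟩ := exists_mem_step_interval
      (t := fun n => ∑ i ∈ Finset.range n, S i) (by simp) hlt
    rw [hX p _ hp1 hp2]
    exact hz p hp
  · intro hj
    rw [if_neg]
    intro hall
    set T := ∑ i ∈ Finset.range k, S i with hT
    have hcl : ⌈T * m⌉₊ ≤ j := Nat.ceil_le.2 ((le_div_iff₀ hm').1 hj)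
    refine hzk ?_
    rw [← hX k ((⌈T * m⌉₊ : ℝ≥0) / m) ?_ ?_]
    · exact hall _ hcl
    · rw [le_div_iff₀ hm']
      exact Nat.le_ceil _
    · rw [div_lt_iff₀ hm', Finset.sum_range_succ, ← hT, add_mul]
      refine (Nat.ceil_lt_add_one zero_le).trans_le ?_
      gcongr
      rw [← inv_le_iff_one_le_mul₀' hS]
      exact hK.le.trans (by exact_mod_cast hKm)

/-- The stochastic integral up to the hitting time of `M` along a jump path. -/
theorem exitIntegral_eq_sum {E Ω : Type*} {lam σ : E → ℝ} (hlam : ∀ x, 0 ≤ lam x)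
    {X : ℝ≥0 → Ω → E} {B : ℝ≥0 → Ω → ℝ} {ω : Ω} {z : ℕ → E} {S : ℕ → ℝ≥0}
    (hX : ∀ (n : ℕ) (s : ℝ≥0), ∑ i ∈ Finset.range n, S i ≤ s →
      s < ∑ i ∈ Finset.range (n + 1), S i → X s ω = z n)
    {k : ℕ} (hz : ∀ i < k, lam (z i) = 0) (hzk : lam (z k) ≠ 0) (hS : ∀ i ≤ k, 0 < S i) :
    exitIntegral lam σ X B ω = ∑ i ∈ Finset.range k, σ (z i) *
      (B (∑ l ∈ Finset.range (i + 1), S l) ω - B (∑ l ∈ Finset.range i, S l) ω) := by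
  have ht : Monotone fun n => ∑ i ∈ Finset.range n, S i :=
    monotone_nat_of_le_succ fun n => by rw [Finset.sum_range_succ]; exact le_self_add
  have hXt : ∀ i ≤ k, X (∑ l ∈ Finset.range i, S l) ω = z i := fun i hi =>
    hX i _ le_rfl (by rw [Finset.sum_range_succ]; exact lt_add_of_pos_right _ (hS i hi))
  have hT : hitTimeM lam X ω = ((∑ i ∈ Finset.range k, S i : ℝ≥0) : WithTop ℝ≥0) := by
    have hmem : 0 < lam (X (∑ i ∈ Finset.range k, S i) ω) := by
      rw [hXt k le_rfl]
      exact lt_of_le_of_ne (hlam _) (Ne.symm hzk)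
    rw [hitTimeM, hittingAfter, if_pos ⟨_, zero_le, hmem⟩]
    congr 1
    refine IsLeast.csInf_eq ⟨⟨zero_le, hmem⟩, fun s hs => ?_⟩
    by_contra hlt
    rw [not_le] at hlt
    obtain ⟨p, hp, hp1, hp2⟩ := exists_mem_step_interval
      (t := fun n => ∑ i ∈ Finset.range n, S i) (by simp) hlt
    have h2 : 0 < lam (X s ω) := hs.2
    rw [hX p s hp1 hp2, hz p hp] at h2
    exact lt_irrefl _ h2
  rw [exitIntegral, hT, WithTop.untopD_coe]
  refine IsStepIntegral.stepIntegral_eq ⟨k, fun n => ∑ i ∈ Finset.range n, S i, ht, by simp, rfl,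
    fun i hi s h1 h2 => ?_, ?_⟩
  · beta_reduce
    rw [hX i s h1 h2, hXt i hi.le]
  · exact Finset.sum_congr rfl fun i hi => by
      beta_reduce
      rw [hXt i (Finset.mem_range.1 hi).le]

end StepPaths

/-! ### Gaussian mixtures and integration against an independent Brownian motion -/

section GaussianMixtures

open Filter Topology Complex

variable {Ω : Type*} [MeasurableSpace Ω] {μ : Measure Ω} [IsProbabilityMeasure μ]

/-- Characteristic function of a linear combination of independent centered Gaussian variables with
random coefficients which are independent of these variables. -/
theorem integral_cexp_sum_mul_gaussian {K : ℕ} {W D : Fin K → Ω → ℝ} {δ : Fin K → ℝ≥0}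
    (hW : ∀ j, Measurable (W j)) (hD : ∀ j, HasLaw (D j) (gaussianReal 0 (δ j)) μ)
    (hDind : iIndepFun D μ) (hWD : IndepFun (fun ω j => W j ω) (fun ω j => D j ω) μ) (θ : ℝ) :
    ∫ ω, cexp (θ * (∑ j, W j ω * D j ω : ℝ) * I) ∂μ =
      ∫ ω, cexp (-(θ ^ 2 / 2 * (∑ j, W j ω ^ 2 * δ j : ℝ))) ∂μ := by
  have hWm : Measurable fun ω j => W j ω := measurable_pi_lambda _ hW
  have hDm : AEMeasurable (fun ω j => D j ω) μ :=
    aemeasurable_pi_lambda _ fun j => (hD j).aemeasurable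
  have hmap := (indepFun_iff_map_prod_eq_prod_map_map hWm.aemeasurable hDm).1 hWD
  -- The joint law is now the law of `W` times a product of Gaussians, so the Gaussian variables can
  -- be integrated out with `W` frozen.
  rw [(iIndepFun_iff_map_fun_eq_pi_map fun j => (hD j).aemeasurable).1 hDind] at hmap
  simp_rw [fun j => (hD j).map_eq] at hmap
  have : IsProbabilityMeasure (μ.map fun ω j => W j ω) :=
    Measure.isProbabilityMeasure_map hWm.aemeasurable
  let F : (Fin K → ℝ) × (Fin K → ℝ) → ℂ := fun p => cexp (θ * (∑ j, p.1 j * p.2 j : ℝ) * I)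
  have hF : Measurable F := by fun_prop
  calc ∫ ω, cexp (θ * (∑ j, W j ω * D j ω : ℝ) * I) ∂μ
      = ∫ p, F p ∂(μ.map fun ω => (fun j => W j ω, fun j => D j ω)) :=
        (integral_map (hWm.aemeasurable.prodMk hDm) hF.aestronglyMeasurable).symm
    _ = ∫ w, ∫ d, F (w, d) ∂(Measure.pi fun j => gaussianReal 0 (δ j))
          ∂(μ.map fun ω j => W j ω) := by
        rw [hmap, integral_prod]
        refine Integrable.of_bound hF.aestronglyMeasurable 1 (ae_of_all _ fun p => ?_)
        change ‖cexp _‖ ≤ 1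
        rw [← Complex.ofReal_mul, Complex.norm_exp_ofReal_mul_I]
    _ = ∫ w, cexp (-(θ ^ 2 / 2 * (∑ j, w j ^ 2 * δ j : ℝ))) ∂(μ.map fun ω j => W j ω) := by
        refine integral_congr_ae (ae_of_all _ fun w => ?_)
        have h1 : ∀ d : Fin K → ℝ, F (w, d) = ∏ j, cexp (((θ * w j : ℝ) : ℂ) * d j * I) := by
          intro d
          rw [← Complex.exp_sum]
          simp only [F]
          push_cast
          rw [Finset.mul_sum, Finset.sum_mul]
          exact congrArg _ (Finset.sum_congr rfl fun j _ => by ring)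
        simp_rw [h1]
        rw [integral_fintype_prod_eq_prod (μ := fun j => gaussianReal 0 (δ j))
          (fun j (d : ℝ) => cexp (((θ * w j : ℝ) : ℂ) * d * I))]
        simp_rw [← charFun_apply_real, charFun_gaussianReal]
        rw [← Complex.exp_sum]
        push_cast
        rw [Finset.mul_sum, ← Finset.sum_neg_distrib]
        exact congrArg _ (Finset.sum_congr rfl fun j _ => by ring)
    _ = _ := by
        refine integral_map hWm.aemeasurable (Measurable.aestronglyMeasurable ?_)
        fun_prop

/-- A random variable with the characteristic function of a mixture of centered Gaussian variables
with random variance `V` has the exponential moments of this mixture. -/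
theorem lintegral_exp_of_charFun_gaussian_mixture {Y V : Ω → ℝ} (hY : AEMeasurable Y μ)
    (hV : Measurable V) (hV0 : ∀ ω, 0 ≤ V ω)
    (h : ∀ θ : ℝ, ∫ ω, cexp (θ * Y ω * I) ∂μ = ∫ ω, cexp (-(θ ^ 2 / 2 * V ω)) ∂μ) (v : ℝ) :
    ∫⁻ ω, ENNReal.ofReal (Real.exp (v * Y ω)) ∂μ =
      ∫⁻ ω, ENNReal.ofReal (Real.exp (v ^ 2 / 2 * V ω)) ∂μ := by
  -- `R` realizes the mixture on an extended space; equal characteristic functions identify its law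
  -- with that of `Y`.
  let R : Ω × ℝ → ℝ := fun p => √(V p.1) * p.2
  have hR : Measurable R := (hV.comp measurable_fst).sqrt.mul measurable_snd
  have hlaw : μ.map Y = (μ.prod (gaussianReal 0 1)).map R := by
    have : IsProbabilityMeasure (μ.map Y) := Measure.isProbabilityMeasure_map hY
    have : IsProbabilityMeasure ((μ.prod (gaussianReal 0 1)).map R) :=
      Measure.isProbabilityMeasure_map hR.aemeasurable
    refine Measure.ext_of_charFun ?_
    ext θ
    have hm : Measurable fun y : ℝ => cexp (θ * y * I) := by fun_prop
    rw [charFun_apply_real, charFun_apply_real, integral_map hY hm.aestronglyMeasurable,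
      integral_map hR.aemeasurable hm.aestronglyMeasurable, h θ, integral_prod]
    · refine integral_congr_ae (ae_of_all _ fun ω => ?_)
      have h1 : ∀ g : ℝ, cexp (θ * (R (ω, g) : ℝ) * I) =
          cexp (((θ * √(V ω) : ℝ) : ℂ) * g * I) := fun g => by
        simp only [R]; push_cast; congr 1; ring
      beta_reduce
      simp_rw [h1]
      rw [← charFun_apply_real, charFun_gaussianReal]
      congr 1
      have h2 : ((√(V ω) : ℝ) : ℂ) ^ 2 = (V ω : ℂ) := by
        rw [← Complex.ofReal_pow, Real.sq_sqrt (hV0 ω)]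
      push_cast
      rw [mul_pow, h2]
      ring
    · refine Integrable.of_bound (hm.comp hR).aestronglyMeasurable 1 (ae_of_all _ fun p => ?_)
      rw [← Complex.ofReal_mul, Complex.norm_exp_ofReal_mul_I]
  have hm : Measurable fun y : ℝ => ENNReal.ofReal (Real.exp (v * y)) := by fun_prop
  rw [← lintegral_map' hm.aemeasurable hY (f := fun y : ℝ => ENNReal.ofReal (Real.exp (v * y))),
    hlaw, lintegral_map hm hR, lintegral_prod _ (by fun_prop)]
  refine lintegral_congr fun ω => ?_
  have h1 : ∀ g : ℝ, v * R (ω, g) = v * √(V ω) * g := fun g => by simp only [R]; ring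
  simp_rw [h1]
  rw [← ofReal_integral_eq_lintegral_ofReal (integrable_exp_mul_gaussianReal _)
    (ae_of_all _ fun _ => (Real.exp_pos _).le)]
  have h2 := mgf_gaussianReal (p := gaussianReal 0 1) (X := id) (μ := 0) (v := 1)
    Measure.map_id (v * √(V ω))
  simp only [mgf, id] at h2
  rw [h2, mul_pow, Real.sq_sqrt (hV0 ω)]
  congr 2
  push_cast
  ring

/-- Passage to the limit in `integral_cexp_sum_mul_gaussian`. -/
theorem lintegral_exp_of_tendsto_gaussian_mixture {Y V : Ω → ℝ} {Ym Vm : ℕ → Ω → ℝ}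
    (hYm : ∀ m, AEMeasurable (Ym m) μ) (hVm : ∀ m, AEMeasurable (Vm m) μ)
    (hVm0 : ∀ m ω, 0 ≤ Vm m ω)
    (h : ∀ (m : ℕ) (θ : ℝ),
      ∫ ω, cexp (θ * Ym m ω * I) ∂μ = ∫ ω, cexp (-(θ ^ 2 / 2 * Vm m ω)) ∂μ)
    (hY : ∀ᵐ ω ∂μ, Tendsto (fun m => Ym m ω) atTop (𝓝 (Y ω)))
    (hV : ∀ᵐ ω ∂μ, Tendsto (fun m => Vm m ω) atTop (𝓝 (V ω))) (v : ℝ) :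
    ∫⁻ ω, ENNReal.ofReal (Real.exp (v * Y ω)) ∂μ =
      ∫⁻ ω, ENNReal.ofReal (Real.exp (v ^ 2 / 2 * V ω)) ∂μ := by
  have hYmeas : AEMeasurable Y μ := aemeasurable_of_tendsto_metrizable_ae atTop hYm hY
  have hVmeas : AEMeasurable V μ := aemeasurable_of_tendsto_metrizable_ae atTop hVm hV
  -- The limit `V` is only almost surely nonnegative and almost everywhere measurable; `V'` is a
  -- version with both properties everywhere.
  set V' : Ω → ℝ := fun ω => max (hVmeas.mk V ω) 0 with hV'
  have hVV' : ∀ᵐ ω ∂μ, V ω = V' ω := by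
    filter_upwards [hVmeas.ae_eq_mk, hV] with ω h1 h2
    simp only [hV']
    rw [← h1, max_eq_left]
    exact ge_of_tendsto' h2 fun m => hVm0 m ω
  -- Both integrands have modulus at most `1`, so dominated convergence applies without any control
  -- of exponential moments.
  have hkey : ∀ θ : ℝ, ∫ ω, cexp (θ * Y ω * I) ∂μ = ∫ ω, cexp (-(θ ^ 2 / 2 * V' ω)) ∂μ := by
    intro θ
    have h1 : Tendsto (fun m => ∫ ω, cexp (θ * Ym m ω * I) ∂μ) atTop
        (𝓝 (∫ ω, cexp (θ * Y ω * I) ∂μ)) := by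
      refine tendsto_integral_of_dominated_convergence (fun _ => 1) (fun m => ?_)
        (integrable_const _) (fun m => ae_of_all _ fun ω => ?_) ?_
      · have : Measurable fun y : ℝ => cexp (θ * y * I) := by fun_prop
        exact (this.comp_aemeasurable (hYm m)).aestronglyMeasurable
      · rw [← Complex.ofReal_mul, Complex.norm_exp_ofReal_mul_I]
      · filter_upwards [hY] with ω hω
        have : Continuous fun y : ℝ => cexp (θ * y * I) := by fun_prop
        exact (this.tendsto _).comp hω
    have h2 : Tendsto (fun m => ∫ ω, cexp (-(θ ^ 2 / 2 * Vm m ω)) ∂μ) atTop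
        (𝓝 (∫ ω, cexp (-(θ ^ 2 / 2 * V' ω)) ∂μ)) := by
      refine tendsto_integral_of_dominated_convergence (fun _ => 1) (fun m => ?_)
        (integrable_const _) (fun m => ae_of_all _ fun ω => ?_) ?_
      · have : Measurable fun y : ℝ => cexp (-(θ ^ 2 / 2 * y)) := by fun_prop
        exact (this.comp_aemeasurable (hVm m)).aestronglyMeasurable
      · have h3 : (-((θ : ℂ) ^ 2 / 2 * (Vm m ω : ℂ))) = ((-(θ ^ 2 / 2 * Vm m ω) : ℝ) : ℂ) := by
          push_cast; ring
        rw [h3, Complex.norm_exp_ofReal, Real.exp_le_one_iff, neg_nonpos]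
        exact mul_nonneg (by positivity) (hVm0 m ω)
      · filter_upwards [hV, hVV'] with ω hω hω'
        rw [← hω']
        have : Continuous fun y : ℝ => cexp (-(θ ^ 2 / 2 * y)) := by fun_prop
        exact (this.tendsto _).comp hω
    simp_rw [h _ θ] at h1
    exact tendsto_nhds_unique h1 h2
  rw [lintegral_exp_of_charFun_gaussian_mixture hYmeas
    (hVmeas.measurable_mk.max measurable_const) (fun ω => le_max_right _ _) hkey v]
  refine lintegral_congr_ae ?_
  filter_upwards [hVV'] with ω hω
  rw [hω]

/-- Characteristic function of the elementary integral, along the grid of mesh `1 / m`, of a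
process independent of the Brownian motion `B`. -/
theorem integral_cexp_sum_mul_brownian {E : Type*} [MeasurableSpace E]
    {B : ℝ≥0 → Ω → ℝ} (hB : IsBrownianReal B μ) {X : ℝ≥0 → Ω → E} (hX : ∀ t, Measurable (X t))
    (hind : IndepFun (fun ω t => X t ω) (fun ω t => B t ω) μ) {G : ℕ → (ℝ≥0 → E) → ℝ}
    (hG : ∀ j, Measurable (G j)) (m K : ℕ) (θ : ℝ) :
    ∫ ω, cexp (θ * (∑ j ∈ Finset.range K, G j (fun t => X t ω) *
        (B (((j + 1 : ℕ) : ℝ≥0) / m) ω - B ((j : ℝ≥0) / m) ω) : ℝ) * I) ∂μ =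
      ∫ ω, cexp (-(θ ^ 2 / 2 * (∑ j ∈ Finset.range K, G j (fun t => X t ω) ^ 2 *
        ((((j + 1 : ℕ) : ℝ≥0) / m : ℝ≥0) - ((j : ℝ≥0) / m : ℝ≥0)) : ℝ))) ∂μ := by
  have hle : ∀ j : ℕ, (j : ℝ≥0) / m ≤ ((j + 1 : ℕ) : ℝ≥0) / m := fun j => by
    gcongr; exact_mod_cast j.le_succ
  have hXm : Measurable fun ω t => X t ω := measurable_pi_lambda _ hX
  have key := integral_cexp_sum_mul_gaussian (μ := μ) (K := K)
    (W := fun j ω => G j (fun t => X t ω))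
    (D := fun j ω => B (((j + 1 : ℕ) : ℝ≥0) / m) ω - B ((j : ℝ≥0) / m) ω)
    (δ := fun j => ((j + 1 : ℕ) : ℝ≥0) / m - (j : ℝ≥0) / m)
    (fun j => (hG j).comp hXm) (fun j => ?_) ?_ ?_ θ
  · simp only [Finset.sum_range]
    rw [key]
    simp only [NNReal.coe_sub (hle _)]
  · have := hB.hasLaw_sub (((j + 1 : ℕ) : ℝ≥0) / m) ((j : ℝ≥0) / m)
    have hδ : nndist ((((j : ℕ) + 1 : ℕ) : ℝ≥0) / m : ℝ≥0).1 (((j : ℕ) : ℝ≥0) / m : ℝ≥0).1 =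
        (((j : ℕ) + 1 : ℕ) : ℝ≥0) / m - ((j : ℕ) : ℝ≥0) / m := by
      rw [← NNReal.coe_inj, NNReal.coe_sub (hle j), coe_nndist, Real.dist_eq]
      exact abs_of_nonneg (sub_nonneg.2 (by exact_mod_cast hle j))
    rw [hδ] at this
    exact this
  · have := hB.hasIndepIncrements.nat (t := fun j : ℕ => (j : ℝ≥0) / m)
      (monotone_nat_of_le_succ hle)
    exact this.precomp (g := fun j : Fin K => (j : ℕ)) Fin.val_injective
  · exact hind.comp (φ := fun p (j : Fin K) => G j p)
      (ψ := fun b (j : Fin K) => b (((j + 1 : ℕ) : ℝ≥0) / m) - b ((j : ℝ≥0) / m))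
      (measurable_pi_lambda _ fun j => hG j)
      (by fun_prop)

end GaussianMixtures

/-! ### Exponential holding times -/

section ExponentialLaw

/-- The truncation `max t 0` admits rays with negative endpoint and matches the coercion of
`Real.toNNReal t` in the joint tails. -/
theorem expMeasure_Ioi {r : ℝ} (hr : 0 < r) (t : ℝ) :
    expMeasure r (Set.Ioi t) = ENNReal.ofReal (Real.exp (-(r * max t 0))) := by
  have := isProbabilityMeasure_expMeasure hr
  rw [← Set.compl_Iic, prob_compl_eq_one_sub measurableSet_Iic, ← ofReal_cdf,
    cdf_expMeasure_eq hr, ← ENNReal.ofReal_one, ← ENNReal.ofReal_sub]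
  · congr 1
    split_ifs with h
    · rw [max_eq_left h]; ring
    · rw [max_eq_right (not_le.1 h).le]; simp
  · split_ifs with h
    · rw [sub_nonneg, Real.exp_le_one_iff, neg_nonpos]
      positivity
    · exact le_rfl

/-- Tilting by `e^{cs}` turns the density of rate `r` into `r / (r - c)` times that of rate `r - c`.
-/
theorem lintegral_exp_mul_expMeasure {r c : ℝ} (hr : 0 < r) (hc : c < r) :
    ∫⁻ s, ENNReal.ofReal (Real.exp (c * s)) ∂(expMeasure r) = ENNReal.ofReal (r / (r - c)) := by
  have hrc : 0 < r - c := sub_pos.2 hc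
  have hexp : expMeasure r = volume.withDensity (exponentialPDF r) := rfl
  have hpdf : Measurable (exponentialPDF r) := (measurable_exponentialPDFReal r).ennreal_ofReal
  rw [hexp, lintegral_withDensity_eq_lintegral_mul _ hpdf (by fun_prop)]
  have : ∀ s, (exponentialPDF r * fun s => ENNReal.ofReal (Real.exp (c * s))) s =
      ENNReal.ofReal (r / (r - c)) * exponentialPDF (r - c) s := by
    intro s
    rw [Pi.mul_apply, exponentialPDF_eq, exponentialPDF_eq, ← ENNReal.ofReal_mul' (by positivity),
      ← ENNReal.ofReal_mul (by positivity)]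
    congr 1
    split_ifs
    · rw [mul_assoc, ← Real.exp_add, ← mul_assoc, div_mul_cancel₀ _ hrc.ne']
      congr 2
      ring
    · simp
  simp_rw [this]
  have hpdf' : Measurable (exponentialPDF (r - c)) :=
    (measurable_exponentialPDFReal _).ennreal_ofReal
  rw [lintegral_const_mul _ hpdf', lintegral_exponentialPDF_eq_one hrc, mul_one]

theorem lintegral_pi_prod {ι : Type*} [Fintype ι] {ν : ι → Measure ℝ}
    [∀ i, IsProbabilityMeasure (ν i)] {f : ι → ℝ → ℝ≥0∞} (hf : ∀ i, Measurable (f i)) :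
    ∫⁻ s, ∏ i, f i (s i) ∂(Measure.pi ν) = ∏ i, ∫⁻ s, f i s ∂(ν i) := by
  have h := lintegral_prod_eq_prod_lintegral_of_indepFun (μ := Measure.pi ν) Finset.univ
    (fun i s => f i (s i)) (iIndepFun_pi fun i => (hf i).aemeasurable)
    (fun i => (hf i).comp (measurable_pi_apply i))
  rw [h]
  refine Finset.prod_congr rfl fun i _ => ?_
  exact (measurePreserving_eval ν i).lintegral_comp (hf i)

variable {Ω : Type*} [MeasurableSpace Ω] {μ : Measure Ω}

/-- Exponential moments of independent exponential times on an event, from the joint tails. -/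
theorem setLIntegral_prod_exp_of_joint_tail {n : ℕ} {S : Fin (n + 1) → Ω → ℝ≥0}
    (hS : ∀ i, Measurable (S i)) {D : Set Ω} {a c : Fin (n + 1) → ℝ}
    (ha : ∀ i, 0 < a i) (hc : ∀ i, c i < a i) {p : ℝ} (hp : 0 ≤ p)
    (h : ∀ t : Fin (n + 1) → ℝ≥0, μ {ω | ω ∈ D ∧ ∀ i, t i < S i ω} =
      ENNReal.ofReal (p * ∏ i, Real.exp (-(a i * t i)))) :
    ∫⁻ ω in {ω | ω ∈ D ∧ ∀ i, 0 < S i ω}, ∏ i, ENNReal.ofReal (Real.exp (c i * S i ω)) ∂μ =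
      ENNReal.ofReal (p * ∏ i, a i / (a i - c i)) := by
  set D' : Set Ω := {ω | ω ∈ D ∧ ∀ i, 0 < S i ω} with hD'
  rcases hp.eq_or_lt with rfl | hp
  · have h0 : μ D' = 0 := by
      have := h 0
      simpa [hD'] using this
    rw [Measure.restrict_eq_zero.2 h0]
    simp
  have hSm : Measurable fun ω i => (S i ω : ℝ) :=
    measurable_pi_lambda _ fun i => (hS i).coe_nnreal_real
  have := fun i => isProbabilityMeasure_expMeasure (ha i)
  have hq : ENNReal.ofReal p ≠ 0 := by simpa using hp
  -- The normalized law of `S` on `D'` is determined by its values on products of rays, a generating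
  -- π-system. The case `p = 0`, where normalization fails, is settled above.
  have hlaw : Measure.pi (fun i => expMeasure (a i)) =
      (ENNReal.ofReal p)⁻¹ • (μ.restrict D').map fun ω i => (S i ω : ℝ) := by
    refine Measure.pi_eq_generateFrom (C := fun _ => Set.range Set.Ioi)
      (fun _ => (borel_eq_generateFrom_Ioi ℝ).symm) (fun _ => isPiSystem_Ioi)
      (fun i => ⟨fun k => Set.Ioi (-(k : ℝ)), fun k => ⟨_, rfl⟩, fun k => measure_lt_top _ _, ?_⟩)
      fun s hs => ?_
    · refine Set.eq_univ_of_forall fun x => ?_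
      obtain ⟨k, hk⟩ := exists_nat_gt (-x)
      exact Set.mem_iUnion.2 ⟨k, by rw [Set.mem_Ioi]; linarith⟩
    · choose t ht using hs
      obtain rfl : (fun i => Set.Ioi (t i)) = s := funext ht
      -- A negative threshold truncates to `0` and demands `0 < S i ω`, which is why positivity is
      -- built into `D'`.
      have hset : (fun ω i => (S i ω : ℝ)) ⁻¹' (Set.univ.pi fun i => Set.Ioi (t i)) ∩ D' =
          {ω | ω ∈ D ∧ ∀ i, Real.toNNReal (t i) < S i ω} := by
        ext ω
        simp only [hD', Set.mem_inter_iff, Set.mem_preimage, Set.mem_univ_pi, Set.mem_Ioi,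
          Set.mem_ofPred_eq]
        simp only [← NNReal.coe_lt_coe, Real.coe_toNNReal', max_lt_iff, NNReal.coe_zero,
          forall_and]
        tauto
      rw [Measure.smul_apply, Measure.map_apply hSm (MeasurableSet.univ_pi fun _ => measurableSet_Ioi),
        Measure.restrict_apply (hSm (MeasurableSet.univ_pi fun _ => measurableSet_Ioi)), hset, h,
        ENNReal.ofReal_mul hp.le, smul_eq_mul, ← mul_assoc,
        ENNReal.inv_mul_cancel hq ENNReal.ofReal_ne_top, one_mul,
        ENNReal.ofReal_prod_of_nonneg fun _ _ => (Real.exp_pos _).le]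
      exact Finset.prod_congr rfl fun i _ => by rw [expMeasure_Ioi (ha i), Real.coe_toNNReal']
  have hF : Measurable fun s : Fin (n + 1) → ℝ => ∏ i, ENNReal.ofReal (Real.exp (c i * s i)) := by
    fun_prop
  have h1 := lintegral_pi_prod (ν := fun i => expMeasure (a i))
    (f := fun i s => ENNReal.ofReal (Real.exp (c i * s))) (fun i => by fun_prop)
  simp_rw [fun i => lintegral_exp_mul_expMeasure (ha i) (hc i)] at h1
  rw [hlaw, lintegral_smul_measure, lintegral_map hF hSm, smul_eq_mul] at h1
  rw [ENNReal.ofReal_mul hp.le, ENNReal.ofReal_prod_of_nonneg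
    fun i _ => (div_pos (ha i) (sub_pos.2 (hc i))).le, ← h1, ← mul_assoc,
    ENNReal.mul_inv_cancel hq ENNReal.ofReal_ne_top, one_mul]

end ExponentialLaw

/-! ### The jump chain and its holding times -/

section JumpChain

open Matrix

variable {E : Type*} [DecidableEq E]

/-- The transition matrix of the embedded chain killed outside of `N`, weighted by the exponential
moments of the holding times. -/
noncomputable def weightedMatrix (A : Matrix E E ℝ) (c : E → ℝ) (N : E → Prop) [DecidablePred N] :
    Matrix E E ℝ :=
  Matrix.of fun x y =>
    if N x then jumpRate A x / (jumpRate A x - c x) * embeddedMatrix A x y else 0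

theorem weightedMatrix_apply (A : Matrix E E ℝ) (c : E → ℝ) (N : E → Prop) [DecidablePred N]
    (x y : E) : weightedMatrix A c N x y =
      if N x then jumpRate A x / (jumpRate A x - c x) * embeddedMatrix A x y else 0 := rfl

/-- Rows of the weighted matrix carry the holding factors of the states left before time `n`; the
terminal vector carries that of the last state. -/
theorem prod_weightedMatrix (A : Matrix E E ℝ) (c : E → ℝ) (N D : E → Prop) [DecidablePred N]
    [DecidablePred D] {n : ℕ} (z : Fin (n + 1) → E) :
    (∏ i : Fin n, weightedMatrix A c N (z i.castSucc) (z i.succ)) *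
      (if D (z (Fin.last n)) then
        jumpRate A (z (Fin.last n)) / (jumpRate A (z (Fin.last n)) - c (z (Fin.last n))) else 0) =
    if (∀ i : Fin n, N (z i.castSucc)) ∧ D (z (Fin.last n)) then
      (∏ i : Fin n, embeddedMatrix A (z i.castSucc) (z i.succ)) *
        ∏ i, jumpRate A (z i) / (jumpRate A (z i) - c (z i)) else 0 := by
  by_cases hD : D (z (Fin.last n))
  · by_cases hN : ∀ i : Fin n, N (z i.castSucc)
    · rw [if_pos hD, if_pos ⟨hN, hD⟩, Fin.prod_univ_castSucc, ← mul_assoc,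
        ← Finset.prod_mul_distrib]
      congr 1
      refine Finset.prod_congr rfl fun i _ => ?_
      rw [weightedMatrix_apply, if_pos (hN i), mul_comm]
    · rw [if_neg (not_and_of_not_left _ hN)]
      obtain ⟨i, hi⟩ := not_forall.1 hN
      have h0 : weightedMatrix A c N (z i.castSucc) (z i.succ) = 0 := by
        rw [weightedMatrix_apply, if_neg hi]
      rw [Finset.prod_eq_zero (Finset.mem_univ i) h0, zero_mul]
  · rw [if_neg hD, if_neg (not_and_of_not_right _ hD), mul_zero]

variable [Fintype E]

/-- If `A x x` were zero, division by zero would make row `x` of the embedded matrix vanish,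
contradicting irreducibility. -/
theorem IsGenerator.jumpRate_pos [Nontrivial E] {A : Matrix E E ℝ} (hA : IsGenerator A)
    (hirr : (embeddedMatrix A).IsIrreducible) (x : E) : 0 < jumpRate A x := by
  obtain ⟨y, hy⟩ := hirr.exists_pos x
  have hne : A x x ≠ 0 := fun h => by simp [embeddedMatrix, h] at hy
  have h1 := hA.row_sum x
  rw [← Finset.add_sum_erase _ _ (Finset.mem_univ x)] at h1
  have h2 : 0 ≤ ∑ y ∈ Finset.univ.erase x, A x y :=
    Finset.sum_nonneg fun y hy => hA.off_diag_nonneg x y (Finset.ne_of_mem_erase hy).symm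
  rw [jumpRate, neg_pos]
  exact lt_of_le_of_ne (by linarith) hne

theorem IsGenerator.embeddedMatrix_row_sum {A : Matrix E E ℝ} (hA : IsGenerator A) {x : E}
    (hx : 0 < jumpRate A x) : ∑ y, embeddedMatrix A x y = 1 := by
  have h1 := hA.row_sum x
  rw [← Finset.add_sum_erase _ _ (Finset.mem_univ x)] at h1
  rw [← Finset.add_sum_erase _ _ (Finset.mem_univ x)]
  have h2 : ∀ y ∈ Finset.univ.erase x, embeddedMatrix A x y = A x y * (-(A x x)⁻¹) := by
    intro y hy
    rw [embeddedMatrix, Matrix.of_apply, if_neg (Finset.ne_of_mem_erase hy).symm, div_eq_mul_inv]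
    ring
  rw [Finset.sum_congr rfl h2, ← Finset.sum_mul]
  have h3 : A x x ≠ 0 := by rw [jumpRate] at hx; linarith
  have h4 : ∑ y ∈ Finset.univ.erase x, A x y = -A x x := by linarith
  rw [h4, embeddedMatrix, Matrix.of_apply, if_pos rfl]
  field_simp
  ring

variable [MeasurableSpace E] {Ω : Type*} [MeasurableSpace Ω] {μ : Measure Ω}

/-- `Z` and `S` are the jump chain and the holding times of the Markov process with generator `A`
started at `x₀`. -/
structure IsJumpChain (A : Matrix E E ℝ) (x₀ : E) (Z : ℕ → Ω → E) (S : ℕ → Ω → ℝ≥0)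
    (μ : Measure Ω) : Prop where
  measurable_chain : ∀ n, Measurable (Z n)
  measurable_time : ∀ n, Measurable (S n)
  law : ∀ (n : ℕ) (z : Fin (n + 1) → E) (t : Fin (n + 1) → ℝ≥0),
      μ {ω | ∀ i : Fin (n + 1), Z i ω = z i ∧ t i < S i ω} =
        ENNReal.ofReal ((if z 0 = x₀ then 1 else 0) *
          (∏ i : Fin n, embeddedMatrix A (z i.castSucc) (z i.succ)) *
          ∏ i : Fin (n + 1), Real.exp (-(jumpRate A (z i) * t i)))

variable [DiscreteMeasurableSpace E]

/-- Exponential moments of the holding times on the event that the chain stays in `N` before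
time `n` and is in `D` at time `n`. -/
theorem IsJumpChain.setLIntegral_prod_exp {A : Matrix E E ℝ} {x₀ : E} {Z : ℕ → Ω → E}
    {S : ℕ → Ω → ℝ≥0} (h : IsJumpChain A x₀ Z S μ) (ha : ∀ x, 0 < jumpRate A x)
    (hP : ∀ x y, 0 ≤ embeddedMatrix A x y) {c : E → ℝ} (hc : ∀ x, c x < jumpRate A x)
    (N D : E → Prop) [DecidablePred N] [DecidablePred D] (n : ℕ) :
    ∫⁻ ω in {ω | ((∀ i < n, N (Z i ω)) ∧ D (Z n ω)) ∧ ∀ i ≤ n, 0 < S i ω},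
      ∏ i ∈ Finset.range (n + 1), ENNReal.ofReal (Real.exp (c (Z i ω) * S i ω)) ∂μ =
    ENNReal.ofReal (((weightedMatrix A c N) ^ n *ᵥ fun y =>
      if D y then jumpRate A y / (jumpRate A y - c y) else 0) x₀) := by
  have hpos : ∀ x, 0 < jumpRate A x / (jumpRate A x - c x) := fun x =>
    div_pos (ha x) (sub_pos.2 (hc x))
  -- The event is split over the admissible trajectories `z`; on each of them the holding times have
  -- explicit joint tails.
  set C : Finset (Fin (n + 1) → E) := Finset.univ.filter fun z =>
    (∀ i : Fin n, N (z i.castSucc)) ∧ D (z (Fin.last n)) with hC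
  set F : (Fin (n + 1) → E) → Set Ω := fun z =>
    {ω | ω ∈ {ω | ∀ i : Fin (n + 1), Z i ω = z i} ∧ ∀ i : Fin (n + 1), 0 < S i ω} with hF
  have hFm : ∀ z, MeasurableSet (F z) := fun z => by
    have h1 : MeasurableSet {ω | ∀ i : Fin (n + 1), Z i ω = z i} := by
      rw [Set.ofPred_forall]
      exact MeasurableSet.iInter fun i => h.measurable_chain i (measurableSet_singleton _)
    have h2 : MeasurableSet {ω | ∀ i : Fin (n + 1), 0 < S i ω} := by
      rw [Set.ofPred_forall]
      exact MeasurableSet.iInter fun i => h.measurable_time i measurableSet_Ioi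
    exact h1.inter h2
  have hunion : {ω | ((∀ i < n, N (Z i ω)) ∧ D (Z n ω)) ∧ ∀ i ≤ n, 0 < S i ω} =
      ⋃ z ∈ C, F z := by
    ext ω
    simp only [Set.mem_iUnion, hC, hF, Finset.mem_filter, Finset.mem_univ, true_and,
      Set.mem_ofPred_eq, exists_prop]
    constructor
    · rintro ⟨⟨h1, h2⟩, h3⟩
      exact ⟨fun i => Z i ω, ⟨fun i => h1 i i.2, h2⟩, fun i => rfl,
        fun i => h3 i (Nat.lt_succ_iff.1 i.2)⟩
    · rintro ⟨z, ⟨h1, h2⟩, h3, h4⟩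
      refine ⟨⟨fun i hi => ?_, ?_⟩, fun i hi => h4 ⟨i, Nat.lt_succ_iff.2 hi⟩⟩
      · have := h3 (Fin.castSucc ⟨i, hi⟩)
        simp only [Fin.val_castSucc] at this
        rw [this]
        exact h1 ⟨i, hi⟩
      · have := h3 (Fin.last n)
        simp only [Fin.val_last] at this
        rw [this]
        exact h2
  have hdisj : (C : Set (Fin (n + 1) → E)).PairwiseDisjoint F := by
    intro z _ z' _ hzz
    refine Set.disjoint_left.2 fun ω hω hω' => hzz ?_
    funext i
    rw [← hω.1 i, ← hω'.1 i]
  have hval : ∀ z, ∫⁻ ω in F z,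
      ∏ i ∈ Finset.range (n + 1), ENNReal.ofReal (Real.exp (c (Z i ω) * S i ω)) ∂μ =
      ENNReal.ofReal ((if z 0 = x₀ then 1 else 0) *
          (∏ i : Fin n, embeddedMatrix A (z i.castSucc) (z i.succ)) *
          ∏ i, jumpRate A (z i) / (jumpRate A (z i) - c (z i))) := by
    intro z
    rw [← setLIntegral_prod_exp_of_joint_tail (S := fun i : Fin (n + 1) => S i)
      (fun i => h.measurable_time i) (D := {ω | ∀ i : Fin (n + 1), Z i ω = z i})
      (fun i => ha (z i)) (fun i => hc (z i))
      (mul_nonneg (by split_ifs <;> simp) (Finset.prod_nonneg fun i _ => hP _ _)) fun t => ?_]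
    · refine setLIntegral_congr_fun (hFm z) fun ω hω => ?_
      rw [Finset.prod_range]
      exact Finset.prod_congr rfl fun i _ => by rw [hω.1 i]
    · rw [← h.law]
      congr 1
      ext ω
      simp only [Set.mem_ofPred_eq, forall_and]
  rw [hunion, lintegral_biUnion_finset hdisj fun z _ => hFm z, Finset.sum_congr rfl
    fun z _ => hval z, ← ENNReal.ofReal_sum_of_nonneg, ← Matrix.sum_path_eq_pow_mulVec]
  · congr 1
    rw [hC, Finset.sum_filter]
    refine Finset.sum_congr rfl fun z _ => ?_
    refine Eq.trans ?_ (mul_assoc _ _ _).symm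
    rw [prod_weightedMatrix]
    split_ifs <;> ring
  · intro z _
    refine mul_nonneg (mul_nonneg (by split_ifs <;> simp) (Finset.prod_nonneg fun i _ => hP _ _))
      (Finset.prod_nonneg fun i _ => (hpos _).le)

variable [IsProbabilityMeasure μ]

/-- With `c = 0` and no constraint on the chain, the moment formula says that the event of positive
times up to `n` has mass `P^n 1 = 1`. -/
theorem IsJumpChain.ae_time_pos {A : Matrix E E ℝ} {x₀ : E} {Z : ℕ → Ω → E}
    {S : ℕ → Ω → ℝ≥0} (h : IsJumpChain A x₀ Z S μ) (ha : ∀ x, 0 < jumpRate A x)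
    (hP : ∀ x y, 0 ≤ embeddedMatrix A x y) (hrow : ∀ x, ∑ y, embeddedMatrix A x y = 1) :
    ∀ᵐ ω ∂μ, ∀ n, 0 < S n ω := by
  rw [ae_all_iff]
  intro n
  have h1 := h.setLIntegral_prod_exp ha hP (c := 0) ha (fun _ => True) (fun _ => True) n
  have hW : weightedMatrix A 0 (fun _ => True) = embeddedMatrix A := by
    ext x y
    simp [weightedMatrix, (ha x).ne']
  have hg : (fun y => if True then jumpRate A y / (jumpRate A y - (0 : E → ℝ) y) else 0) =
      fun _ => (1 : ℝ) := by
    funext y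
    simp [(ha y).ne']
  have hone : ∀ k : ℕ, (embeddedMatrix A ^ k) *ᵥ (fun _ => (1 : ℝ)) = fun _ => 1 := by
    intro k
    induction k with
    | zero => simp
    | succ k ih =>
      rw [pow_succ, ← Matrix.mulVec_mulVec]
      have : embeddedMatrix A *ᵥ (fun _ => (1 : ℝ)) = fun _ => 1 := by
        funext x
        simp [Matrix.mulVec, dotProduct, hrow]
      rw [this, ih]
  rw [hW, hg, hone] at h1
  simp only [Pi.zero_apply, zero_mul, Real.exp_zero, ENNReal.ofReal_one, Finset.prod_const_one,
    lintegral_one, Measure.restrict_apply MeasurableSet.univ, Set.univ_inter, implies_true,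
    true_and] at h1
  have hm : MeasurableSet {ω | ∀ i ≤ n, 0 < S i ω} := by
    simp only [Set.ofPred_forall]
    exact MeasurableSet.iInter fun i => MeasurableSet.iInter fun _ =>
      h.measurable_time i measurableSet_Ioi
  have h2 := (prob_compl_eq_zero_iff hm).2 h1
  filter_upwards [mem_ae_iff.2 h2] with ω hω
  exact hω n le_rfl

/-- With `c = 0`, the moment formula gives the probability of staying in `N` up to step `n`, which
tends to `0` by irreducibility. -/
theorem IsJumpChain.ae_exists_notMem {A : Matrix E E ℝ} {x₀ : E} {Z : ℕ → Ω → E}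
    {S : ℕ → Ω → ℝ≥0} (h : IsJumpChain A x₀ Z S μ) (ha : ∀ x, 0 < jumpRate A x)
    (hirr : (embeddedMatrix A).IsIrreducible) (hrow : ∀ x, ∑ y, embeddedMatrix A x y = 1)
    (N : E → Prop) (hN : ∃ x, ¬ N x) :
    ∀ᵐ ω ∂μ, ∃ n, ¬ N (Z n ω) := by
  classical
  have hpos := h.ae_time_pos ha hirr.nonneg hrow
  have h1 := fun n => h.setLIntegral_prod_exp ha hirr.nonneg (c := 0) ha N N n
  have hW : weightedMatrix A 0 N = Matrix.of fun x y => if N x then embeddedMatrix A x y else 0 := by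
    ext x y
    simp [weightedMatrix, (ha x).ne']
  have hg : (fun y => if N y then jumpRate A y / (jumpRate A y - (0 : E → ℝ) y) else 0) =
      fun y => if N y then (1 : ℝ) else 0 := by
    funext y
    simp [(ha y).ne']
  simp only [hW, hg] at h1
  simp only [Pi.zero_apply, zero_mul, Real.exp_zero, ENNReal.ofReal_one,
    Finset.prod_const_one, lintegral_one, Measure.restrict_apply MeasurableSet.univ,
    Set.univ_inter] at h1
  have hlim := ENNReal.tendsto_ofReal
    (Matrix.tendsto_pow_mulVec_indicator_zero hirr hrow N hN x₀)
  rw [ENNReal.ofReal_zero] at hlim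
  simp_rw [← h1] at hlim
  rw [ae_iff]
  have hle : ∀ n, μ {ω | ¬ ∃ n, ¬ N (Z n ω)} ≤
      μ {ω | ((∀ i < n, N (Z i ω)) ∧ N (Z n ω)) ∧ ∀ i ≤ n, 0 < S i ω} := by
    intro n
    refine measure_mono_ae ?_
    filter_upwards [hpos] with ω hω hω'
    have h2 : ∀ n, N (Z n ω) := fun n => by
      by_contra h3
      exact hω' ⟨n, h3⟩
    exact ⟨⟨fun i _ => h2 i, h2 n⟩, fun i _ => hω i⟩
  exact le_antisymm (ge_of_tendsto' hlim hle) zero_le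

end JumpChain

/-! ### Exponential moments of the integral up to the exit time -/

section ExitTime

open Filter Topology Matrix

variable {E : Type*} {Ω : Type*}

open Classical in
/-- The integral of `σ ^ 2` along the path with jump chain `Z` and holding times `S`, up to the
hitting time of `{lam ≠ 0}`. -/
noncomputable def exitVariance (lam σ : E → ℝ) (Z : ℕ → Ω → E) (S : ℕ → Ω → ℝ≥0) (ω : Ω) : ℝ :=
  if h : ∃ n, ¬ lam (Z n ω) = 0 then
    ∑ i ∈ Finset.range (Nat.find h), σ (Z i ω) ^ 2 * S i ω else 0

theorem exitVariance_eq {lam σ : E → ℝ} {Z : ℕ → Ω → E} {S : ℕ → Ω → ℝ≥0} {ω : Ω} {k : ℕ}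
    (hk : ∀ i < k, lam (Z i ω) = 0) (hk' : ¬ lam (Z k ω) = 0) :
    exitVariance lam σ Z S ω = ∑ i ∈ Finset.range k, σ (Z i ω) ^ 2 * S i ω := by
  have h : ∃ n, ¬ lam (Z n ω) = 0 := ⟨k, hk'⟩
  rw [exitVariance, dif_pos h]
  congr 2
  exact (Nat.find_eq_iff h).2 ⟨hk', fun i hi => not_not.2 (hk i hi)⟩

theorem exitVariance_nonneg (lam σ : E → ℝ) (Z : ℕ → Ω → E) (S : ℕ → Ω → ℝ≥0) (ω : Ω) :
    0 ≤ exitVariance lam σ Z S ω := by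
  rw [exitVariance]
  split_ifs
  · positivity
  · exact le_rfl

variable [MeasurableSpace E] [DiscreteMeasurableSpace E] [MeasurableSpace Ω] {μ : Measure Ω}

/-- Given the path of `X`, the integral with respect to an independent Brownian motion is a
centered Gaussian variable. -/
theorem lintegral_exp_exitIntegral [IsProbabilityMeasure μ] {lam σ : E → ℝ} (hlam : ∀ x, 0 ≤ lam x)
    {B : ℝ≥0 → Ω → ℝ} (hB : IsBrownianReal B μ) {X : ℝ≥0 → Ω → E} (hX : ∀ t, Measurable (X t))
    (hind : IndepFun (fun ω t => X t ω) (fun ω t => B t ω) μ) {Z : ℕ → Ω → E} {S : ℕ → Ω → ℝ≥0}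
    (hpath : ∀ᵐ ω ∂μ, ∀ (n : ℕ) (s : ℝ≥0), ∑ i ∈ Finset.range n, S i ω ≤ s →
      s < ∑ i ∈ Finset.range (n + 1), S i ω → X s ω = Z n ω)
    (hS : ∀ᵐ ω ∂μ, ∀ n, 0 < S n ω) (hexit : ∀ᵐ ω ∂μ, ∃ n, ¬ lam (Z n ω) = 0) (v : ℝ) :
    ∫⁻ ω, ENNReal.ofReal (Real.exp (v * exitIntegral lam σ X B ω)) ∂μ =
      ∫⁻ ω, ENNReal.ofReal (Real.exp (v ^ 2 / 2 * exitVariance lam σ Z S ω)) ∂μ := by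
  -- `G m j` reads the path only at finitely many grid times, hence is measurable on path space; it
  -- kills `σ` after the first grid visit to `M`.
  let G : ℕ → ℕ → (ℝ≥0 → E) → ℝ := fun m j p =>
    if ∀ i ≤ j, lam (p ((i : ℝ≥0) / m)) = 0 then σ (p ((j : ℝ≥0) / m)) else 0
  have hG : ∀ m j, Measurable (G m j) := by
    intro m j
    refine Measurable.ite ?_ ((Measurable.of_discrete (f := σ)).comp (measurable_pi_apply _))
      measurable_const
    simp only [Set.ofPred_forall]
    refine MeasurableSet.iInter fun i => MeasurableSet.iInter fun _ => ?_
    exact ((Measurable.of_discrete (f := lam)).comp (measurable_pi_apply _))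
      (measurableSet_singleton 0)
  have hXm : Measurable fun ω t => X t ω := measurable_pi_lambda _ hX
  have hle : ∀ m j : ℕ, (j : ℝ≥0) / m ≤ ((j + 1 : ℕ) : ℝ≥0) / m := fun m j => by
    gcongr; exact_mod_cast j.le_succ
  have hpaths : ∀ᵐ ω ∂μ, ∃ k, (∀ i < k, lam (Z i ω) = 0) ∧ ¬ lam (Z k ω) = 0 := by
    filter_upwards [hexit] with ω hω
    classical
    exact ⟨Nat.find hω, fun i hi => not_not.1 (Nat.find_min hω hi), Nat.find_spec hω⟩
  refine lintegral_exp_of_tendsto_gaussian_mixture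
    (Ym := fun m ω => ∑ j ∈ Finset.range (m ^ 2), G m j (fun t => X t ω) *
      (B (((j + 1 : ℕ) : ℝ≥0) / m) ω - B ((j : ℝ≥0) / m) ω))
    (Vm := fun m ω => ∑ j ∈ Finset.range (m ^ 2), G m j (fun t => X t ω) ^ 2 *
      ((((j + 1 : ℕ) : ℝ≥0) / m : ℝ≥0) - ((j : ℝ≥0) / m : ℝ≥0) : ℝ))
    (fun m => ?_) (fun m => ?_) (fun m ω => ?_)
    (fun m θ => integral_cexp_sum_mul_brownian hB hX hind (hG m) m (m ^ 2) θ) ?_ ?_ v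
  · refine Finset.aemeasurable_fun_sum _ fun j _ => ?_
    exact ((hG m j).comp hXm).aemeasurable.mul ((hB.aemeasurable _).sub (hB.aemeasurable _))
  · refine (Finset.measurable_fun_sum _ fun j _ => ?_).aemeasurable
    exact (((hG m j).comp hXm).pow_const 2).mul_const _
  · refine Finset.sum_nonneg fun j _ => mul_nonneg (sq_nonneg _) (sub_nonneg.2 ?_)
    exact_mod_cast hle m j
  · filter_upwards [hpath, hS, hpaths, hB.cont] with ω h1 h2 ⟨k, h3, h4⟩ h5
    rw [exitIntegral_eq_sum hlam h1 h3 h4 fun i _ => h2 i]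
    exact tendsto_riemannSum_jumpPath h1 (fun x => lam x = 0) h3 h4 (h2 k) σ h5
  · filter_upwards [hpath, hS, hpaths] with ω h1 h2 ⟨k, h3, h4⟩
    rw [exitVariance_eq h3 h4]
    -- The same convergence with integrator `b s = s` and integrand `σ ^ 2` gives the variance.
    have h6 := tendsto_riemannSum_jumpPath h1 (fun x => lam x = 0) h3 h4 (h2 k)
      (fun x => σ x ^ 2) NNReal.continuous_coe
    have h7 : ∀ i, ((∑ l ∈ Finset.range (i + 1), S l ω : ℝ≥0) : ℝ) -
        (∑ l ∈ Finset.range i, S l ω : ℝ≥0) = S i ω := fun i => by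
      rw [Finset.sum_range_succ]; push_cast; ring
    simp only [h7] at h6
    refine h6.congr fun m => Finset.sum_congr rfl fun j _ => ?_
    simp only [G, ite_pow, ne_eq, OfNat.ofNat_ne_zero, not_false_eq_true, zero_pow]

variable [Fintype E] [DecidableEq E]

/-- The space is partitioned by the exit step `k`. The weight vanishes on `M`, so the holding time
in the exit state, which is not part of the variance, contributes a factor `1`. -/
theorem lintegral_exp_exitVariance {A : Matrix E E ℝ} {x₀ : E} {Z : ℕ → Ω → E}
    {S : ℕ → Ω → ℝ≥0} (h : IsJumpChain A x₀ Z S μ) (ha : ∀ x, 0 < jumpRate A x)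
    (hP : ∀ x y, 0 ≤ embeddedMatrix A x y) {lam σ : E → ℝ} {v : ℝ}
    (hc : ∀ x, (if lam x = 0 then v ^ 2 / 2 * σ x ^ 2 else 0) < jumpRate A x)
    (hS : ∀ᵐ ω ∂μ, ∀ n, 0 < S n ω) (hexit : ∀ᵐ ω ∂μ, ∃ n, ¬ lam (Z n ω) = 0) :
    ∫⁻ ω, ENNReal.ofReal (Real.exp (v ^ 2 / 2 * exitVariance lam σ Z S ω)) ∂μ =
      ∑' k, ENNReal.ofReal (((weightedMatrix A
        (fun x => if lam x = 0 then v ^ 2 / 2 * σ x ^ 2 else 0) (fun x => lam x = 0)) ^ k *ᵥ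
          fun y => if lam y = 0 then 0 else 1) x₀) := by
  set c : E → ℝ := fun x => if lam x = 0 then v ^ 2 / 2 * σ x ^ 2 else 0 with hcdef
  set D : ℕ → Set Ω := fun k =>
    {ω | ((∀ i < k, lam (Z i ω) = 0) ∧ ¬ lam (Z k ω) = 0) ∧ ∀ i ≤ k, 0 < S i ω} with hD
  have hZm : ∀ i, MeasurableSet {ω | lam (Z i ω) = 0} := fun i =>
    ((Measurable.of_discrete (f := lam)).comp (h.measurable_chain i)) (measurableSet_singleton 0)
  have hDm : ∀ k, MeasurableSet (D k) := fun k => by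
    have h1 : MeasurableSet {ω | ∀ i < k, lam (Z i ω) = 0} := by
      simp only [Set.ofPred_forall]
      exact MeasurableSet.iInter fun i => MeasurableSet.iInter fun _ => hZm i
    have h2 : MeasurableSet {ω | ∀ i ≤ k, 0 < S i ω} := by
      simp only [Set.ofPred_forall]
      exact MeasurableSet.iInter fun i => MeasurableSet.iInter fun _ =>
        h.measurable_time i measurableSet_Ioi
    exact (h1.inter (hZm k).compl).inter h2
  have hdisj : Pairwise (Function.onFun Disjoint D) := by
    intro k l hkl
    refine Set.disjoint_left.2 fun ω hω hω' => ?_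
    rcases lt_or_gt_of_ne hkl with hlt | hlt
    · exact hω.1.2 (hω'.1.1 k hlt)
    · exact hω'.1.2 (hω.1.1 l hlt)
  have hcover : ∀ᵐ ω ∂μ, ω ∈ ⋃ k, D k := by
    filter_upwards [hS, hexit] with ω h1 h2
    classical
    exact Set.mem_iUnion.2 ⟨Nat.find h2, ⟨fun i hi => not_not.1 (Nat.find_min h2 hi),
      Nat.find_spec h2⟩, fun i _ => h1 i⟩
  rw [← Measure.restrict_eq_self_of_ae_mem hcover, lintegral_iUnion hDm hdisj]
  refine tsum_congr fun k => ?_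
  have hg : (fun y => if lam y = 0 then (0 : ℝ) else 1) =
      fun y => if ¬ lam y = 0 then jumpRate A y / (jumpRate A y - c y) else 0 := by
    funext y
    by_cases hy : lam y = 0
    · simp [hy]
    · simp [hcdef, hy, (ha y).ne']
  rw [hg, ← h.setLIntegral_prod_exp ha hP hc (fun x => lam x = 0) (fun x => ¬ lam x = 0) k]
  refine setLIntegral_congr_fun (hDm k) fun ω hω => ?_
  rw [exitVariance_eq hω.1.1 hω.1.2, ← ENNReal.ofReal_prod_of_nonneg
    fun _ _ => (Real.exp_pos _).le, ← Real.exp_sum, Finset.sum_range_succ]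
  rw [if_neg hω.1.2, zero_mul, add_zero, Finset.mul_sum]
  congr 2
  refine Finset.sum_congr rfl fun i hi => ?_
  rw [if_pos (hω.1.1 i (Finset.mem_range.1 hi)), mul_assoc]

end ExitTime

/-! ### The equivalence -/

section MainResult

/-- Since `β(x) > 0`, the maximum is positive and its inverse is a genuine one. -/
theorem betaCoeff_mul_sq_lt_one {E : Type*} [Fintype E] {A : Matrix E E ℝ} {lam σ : E → ℝ}
    (ha : ∀ x, 0 < jumpRate A x) (hσ : ∀ x, 0 < σ x) {v : ℝ} (hv : v ^ 2 < (betaBar A lam σ)⁻¹)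
    {x : E} (hx : lam x = 0) : betaCoeff A σ x * v ^ 2 < 1 := by
  have hβ : 0 < betaCoeff A σ x :=
    div_pos (pow_pos (hσ x) 2) (mul_pos two_pos (ha x))
  have hle : betaCoeff A σ x ≤ betaBar A lam σ :=
    le_ciSup (f := fun x : NullState lam => betaCoeff A σ x) (Set.finite_range _).bddAbove ⟨x, hx⟩
  have hb : 0 < betaBar A lam σ := hβ.trans_le hle
  calc betaCoeff A σ x * v ^ 2 ≤ betaBar A lam σ * v ^ 2 := by gcongr
    _ < betaBar A lam σ * (betaBar A lam σ)⁻¹ := by gcongr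
    _ = 1 := mul_inv_cancel₀ hb.ne'

/-- Identifies the exponential moment of a holding time with the factor in `P_v^{(N)}`. -/
theorem jumpRate_div_sub_eq {E : Type*} {A : Matrix E E ℝ} {σ : E → ℝ} {v : ℝ} {x : E}
    (ha : 0 < jumpRate A x) :
    jumpRate A x / (jumpRate A x - v ^ 2 / 2 * σ x ^ 2) = 1 / (1 - betaCoeff A σ x * v ^ 2) := by
  have h : jumpRate A x - v ^ 2 / 2 * σ x ^ 2 =
      jumpRate A x * (1 - betaCoeff A σ x * v ^ 2) := by
    rw [betaCoeff]
    field_simp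
  rw [h, div_mul_eq_div_div, div_self ha.ne']

end MainResult

theorem mainTheorem9 {E : Type*} [Fintype E] [DecidableEq E] [MeasurableSpace E]
    [DiscreteMeasurableSpace E]
    (A : Matrix E E ℝ) (hA : IsGenerator A) (hirr : (embeddedMatrix A).IsIrreducible)
    (lam σ : E → ℝ) (hlam : ∀ x, 0 ≤ lam x) (hN : ∃ x, lam x = 0) (hM : ∃ x, 0 < lam x)
    (hσ : ∀ x, 0 < σ x)
    {Ω : Type*} [MeasurableSpace Ω] (μ : Measure Ω) [IsProbabilityMeasure μ]
    (B : ℝ≥0 → Ω → ℝ) (hB : IsBrownianReal B μ)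
    (X : E → ℝ≥0 → Ω → E) (hX : ∀ x, lam x = 0 → IsMarkovProcessFrom A x (X x) μ)
    (hindep : ∀ x, lam x = 0 → IndepFun (fun ω t => X x t ω) (fun ω t => B t ω) μ)
    (v : ℝ) (hv : v ^ 2 < (betaBar A lam σ)⁻¹) :
    (∀ x, lam x = 0 →
        ∫⁻ ω, ENNReal.ofReal (Real.exp (v * exitIntegral lam σ (X x) B ω)) ∂μ < ⊤) ↔
      matrixSpectralRadius (matrixPN A lam σ v) < 1 := by
  obtain ⟨x₀, hx₀⟩ := hN
  obtain ⟨x₁, hx₁⟩ := hM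
  have : Nontrivial E := ⟨x₀, x₁, fun h => by rw [← h, hx₀] at hx₁; exact lt_irrefl _ hx₁⟩
  have : Nonempty (NullState lam) := ⟨⟨x₀, hx₀⟩⟩
  have ha := hA.jumpRate_pos hirr
  have hrow := fun x => hA.embeddedMatrix_row_sum (ha x)
  set c : E → ℝ := fun x => if lam x = 0 then v ^ 2 / 2 * σ x ^ 2 else 0 with hcdef
  have hfac : ∀ x, lam x = 0 →
      jumpRate A x / (jumpRate A x - c x) = 1 / (1 - betaCoeff A σ x * v ^ 2) := fun x hx => by
    have h1 : c x = v ^ 2 / 2 * σ x ^ 2 := if_pos hx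
    rw [h1, jumpRate_div_sub_eq (ha x)]
  have hc : ∀ x, c x < jumpRate A x := by
    intro x
    by_cases hx : lam x = 0
    · have h1 := betaCoeff_mul_sq_lt_one ha hσ hv hx
      have h2 : c x = v ^ 2 / 2 * σ x ^ 2 := if_pos hx
      rw [betaCoeff, div_mul_eq_mul_div, div_lt_one (mul_pos two_pos (ha x))] at h1
      rw [h2]
      linarith
    · have h2 : c x = 0 := if_neg hx
      rw [h2]
      exact ha x
  set W := weightedMatrix A c (fun x => lam x = 0) with hW
  have hW0 : ∀ x y, ¬ lam x = 0 → W x y = 0 := fun x y hx => by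
    rw [hW, weightedMatrix_apply, if_neg hx]
  have hWnn : ∀ x y, 0 ≤ W x y := fun x y => by
    rw [hW, weightedMatrix_apply]
    split_ifs
    · exact mul_nonneg (div_pos (ha x) (sub_pos.2 (hc x))).le (hirr.nonneg x y)
    · exact le_rfl
  have hWN : (Matrix.of fun x y : NullState lam => W x y) = matrixPN A lam σ v := by
    ext x y
    rw [Matrix.of_apply, hW, weightedMatrix_apply, if_pos x.2, hfac x x.2]
    rfl
  have hQ : ∀ x y, 0 ≤ matrixPN A lam σ v x y := fun x y => by
    rw [← hWN]
    exact hWnn x y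
  set g : E → ℝ := fun y => if lam y = 0 then 0 else 1 with hg
  have hgnn : ∀ y, 0 ≤ g y := fun y => by
    simp only [hg]
    split_ifs <;> norm_num
  -- `r` weighs an exit at the next jump. Unlike `g`, it is supported in `N`, so its potential can
  -- be computed with the restricted matrix.
  set r : E → ℝ := Matrix.mulVec W g with hr
  have hr0 : ∀ x, ¬ lam x = 0 → r x = 0 := fun x hx => by
    simp [hr, Matrix.mulVec, dotProduct, hW0 x _ hx]
  have hrnn : ∀ x, 0 ≤ r x := Matrix.mulVec_nonneg_of_nonneg hWnn hgnn
  -- The lower bound `1` supplies the positivity of the potential required by the spectral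
  -- criterion.
  have key : ∀ x : NullState lam,
      ∫⁻ ω, ENNReal.ofReal (Real.exp (v * exitIntegral lam σ (X x) B ω)) ∂μ =
        ∑' k, ENNReal.ofReal (Matrix.mulVec (matrixPN A lam σ v ^ k) (fun y : NullState lam => r y) x) ∧
      1 ≤ ∫⁻ ω, ENNReal.ofReal (Real.exp (v * exitIntegral lam σ (X x) B ω)) ∂μ := by
    rintro ⟨x, hx⟩
    obtain ⟨hXm, Z, S, hZ, hS, hlaw, hpath⟩ := hX x hx
    have hJ : IsJumpChain A x Z S μ := ⟨hZ, hS, hlaw⟩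
    have hpos := hJ.ae_time_pos ha hirr.nonneg hrow
    have hexit := hJ.ae_exists_notMem ha hirr hrow (fun x => lam x = 0) ⟨x₁, hx₁.ne'⟩
    rw [lintegral_exp_exitIntegral hlam hB hXm (hindep x hx) hpath hpos hexit v]
    constructor
    · rw [lintegral_exp_exitVariance hJ ha hirr.nonneg hc hpos hexit,
        tsum_eq_zero_add' ENNReal.summable]
      -- Starting in `N`, exit at step `0` is impossible; dropping this term shifts the index and
      -- turns `g` into `r = W g`.
      have h0 : Matrix.mulVec (W ^ 0) g x = 0 := by
        rw [pow_zero, Matrix.one_mulVec]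
        exact if_pos hx
      rw [h0, ENNReal.ofReal_zero, zero_add]
      refine tsum_congr fun k => ?_
      rw [pow_succ, ← Matrix.mulVec_mulVec, ← hWN]
      exact congrArg _ (Matrix.pow_mulVec_eq_submatrix (fun x => lam x = 0) hW0 hr0 k ⟨x, hx⟩)
    · rw [← measure_univ (μ := μ), ← lintegral_one]
      refine lintegral_mono fun ω => ?_
      rw [ENNReal.one_le_ofReal, Real.one_le_exp_iff]
      exact mul_nonneg (by positivity) (exitVariance_nonneg _ _ _ _ _)
  rw [← Matrix.tsum_pow_mulVec_lt_top_iff hQ (r := fun y : NullState lam => r y)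
    (fun y => hrnn y) fun y => by
      rw [← (key y).1]
      exact one_pos.trans_le (key y).2]
  constructor
  · intro h y
    rw [← (key y).1]
    exact h y y.2
  · intro h x hx
    rw [(key ⟨x, hx⟩).1]
    exact h ⟨x, hx⟩
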